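/- Let $\mathbb{D}=\{z\in\mathbb{C}:|z|<1\}$. Let $\mathcal{C}_1$ be the class of analytic functions $f$ on $\mathbb{D}$ for which there is a convex function $g$ (that is, $g$ is analytic and univalent on $\mathbb{D}$ and $g(\mathbb{D})$ is a convex set) of the form $g(z)=b_1z+b_2z^2+\cdots$ with $\operatorname{Re} b_1>0$ such that $$\operatorname{Re}\left(\frac{zf'(z)}{g(z)}\right)>0\qquad (z\in\mathbb{D}),$$ where the quotient is understood at $z=0$ as its limit. Let $N\ge 2$ be an integer. Then the equation $$\frac{2r}{1-r}+\log(1-r)+\sum_{n=N}^{\infty}\left(2-\frac1n\right)r^n-(1-\log 2)=0$$ has a unique root $r=r_{1,N}$ in $(0,1)$, and for every $f(z)=z+\sum_{n=2}^{\infty}a_nz^n\in\mathcal{C}_1$ the series $\sum_{n=N}^\infty |a_nz^n|$ converges and $$|f(z)|+\sum_{n=N}^{\infty}|a_nz^n|\le d\big(f(0),\partial f(\mathbb{D})\big)\qquad\text{for } |z|\le r_{1,N},$$ where $d$ denotes the Euclidean distance and $\partial f(\mathbb{D})$ the boundary of $f(\mathbb{D})$. The radius $r_{1,N}$ is sharp: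 there is a function $f(z)=z+\sum_{n=2}^\infty a_nz^n\in\mathcal{C}_1$ for which equality holds at some $z$ with $|z|=r_{1,N}$, and for which, for every $\rho\in(r_{1,N},1)$, the inequality fails at some $z$ with $|z|=\rho$. -/

import Mathlib

/-- `g` is a convex function on the open unit disc: it is analytic and univalent there and
maps the disc onto a convex set. -/
def IsConvexFunction (g : ℂ → ℂ) : Prop :=
  DifferentiableOn ℂ g (Metric.ball 0 1) ∧
  Set.InjOn g (Metric.ball 0 1) ∧
  Convex ℝ (g '' Metric.ball 0 1)

/-- The class of functions `f`, analytic in the open unit disc, for which there is a convex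
function `g(z) = b₁ z + ⋯` with `Re b₁ > 0` and `Re (z f'(z) / g(z)) > 0` in the disc.
Since `g` is univalent with `g 0 = 0`, the quotient has a single, removable singularity at `0`.
The condition is imposed for `z ≠ 0`; the positivity of the real part of the value `f'(0) / b₁`
at the removable singularity then follows by the minimum principle. -/
def ClassC1 : Set (ℂ → ℂ) :=
  {f | DifferentiableOn ℂ f (Metric.ball 0 1) ∧
    ∃ g : ℂ → ℂ, IsConvexFunction g ∧ g 0 = 0 ∧ 0 < (deriv g 0).re ∧
      ∀ z ∈ Metric.ball (0 : ℂ) 1, z ≠ 0 → 0 < (z * deriv f z / g z).re}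

/-- The functions of `ClassC1` of the form `f(z) = z + a₂ z² + a₃ z³ + ⋯`. -/
def NormalizedC1 : Set (ℂ → ℂ) :=
  {f | f ∈ ClassC1 ∧ f 0 = 0 ∧ deriv f 0 = 1}

/-- The `n`-th Taylor coefficient of `f` at the origin. -/
noncomputable def taylorCoeff (f : ℂ → ℂ) (n : ℕ) : ℂ :=
  iteratedDeriv n f 0 / (n.factorial : ℂ)

/-- The Euclidean distance `d(f(0), ∂ f(𝔻))`. -/
noncomputable def boundaryDist (f : ℂ → ℂ) : ℝ :=
  Metric.infDist (f 0) (frontier (f '' Metric.ball 0 1))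

/-- The Bohr–Rogosinski sum `|f(z)| + ∑_{n ≥ N} |a_n z^n|`. -/
noncomputable def bohrRogosinskiSum (N : ℕ) (f : ℂ → ℂ) (z : ℂ) : ℝ :=
  ‖f z‖ + ∑' k : ℕ, ‖taylorCoeff f (N + k) * z ^ (N + k)‖

/-- The function `2r/(1-r) + log(1-r) + ∑_{n ≥ N} (2 - 1/n) r^n - (1 - log 2)`. -/
noncomputable def radiusFun (N : ℕ) (r : ℝ) : ℝ :=
  2 * r / (1 - r) + Real.log (1 - r)
    + ∑' k : ℕ, (2 - 1 / ((N + k : ℕ) : ℝ)) * r ^ (N + k)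
    - (1 - Real.log 2)

/-! Write `f' = p · u` with `u(z) = g(z)/z` and `Re p > 0`, `p(0) = 1/b₁`. Everything follows from
sharp bounds on the two factors, in which `|b₁|` cancels.

Upper side: Rogosinski's theorem gives `|b_k| ≤ |b₁|` for the convex `g`, Carathéodory's gives
`|p_k| ≤ 2 Re p(0) ≤ 2/|b₁|`. The Cauchy product yields `n|a_n| ≤ 2n - 1`, and summation bounds both
`|f(z)|` and the tail. Carathéodory's bound is Rogosinski's theorem for the half-plane map
`z/(1-z)`.

Lower side: with `r = |z|`, `|p(z)| ≥ (1-r)/(|b₁|(1+r))` is a Schwarz estimate, and `|u(z)| ≥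
|b₁|/(1+r)` comes from starlikeness of order one half. So `|f'(z)| ≥ (1-r)/(1+r)²`. Since `f` is
univalent, the segment from 0 to a nearest omitted value can be lifted, and integration shows that
`f(𝔻)` contains the disc of radius `∫₀¹ (1-r)/(1+r)² dr = 1 - log 2`. Univalence is proved with the
chain `f + t g`, `t ≥ 0`: a coincidence of values at one `t` would persist for larger `t`, against
compactness.

The radius is where the increasing majorant meets `1 - log 2`. The choice `g = z/(1-z)`, `p =
(1+z)/(1-z)` attains the upper bounds on the positive axis, and the lower one at the boundary point
`-1`. -/

open Metric Set Filter Topology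

/-! ### Univalent maps: inverses, lifts, subordination -/

/-- The local inverse of an injective holomorphic function on a connected open set is
holomorphic, and the derivative does not vanish. -/
theorem Set.InjOn.exists_holomorphic_inverse {U : Set ℂ} {g : ℂ → ℂ} (hU : IsOpen U)
    (hUc : IsPreconnected U) (hg : DifferentiableOn ℂ g U) (hinj : InjOn g U) :
    IsOpen (g '' U) ∧ (∀ z ∈ U, deriv g z ≠ 0) ∧
      ∃ h : ℂ → ℂ, DifferentiableOn ℂ h (g '' U) ∧ ∀ z ∈ U, h (g z) = z := by
  have han : AnalyticOnNhd ℂ g U := hg.analyticOnNhd hU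
  have hnc : ∀ z ∈ U, ∀ V ∈ 𝓝 z, ∃ y ∈ V ∩ U, g y ≠ g z := by
    intro z hz V hV
    have h1 : V ∩ U ∈ 𝓝 z := inter_mem hV (hU.mem_nhds hz)
    have h2 : ∀ᶠ y in 𝓝[≠] z, y ∈ V ∩ U := mem_nhdsWithin_of_mem_nhds h1
    obtain ⟨y, hy, hyz⟩ := (h2.and self_mem_nhdsWithin).exists
    exact ⟨y, hy, fun h => hyz (hinj hy.2 hz h)⟩
  have hop : ∀ s ⊆ U, IsOpen s → IsOpen (g '' s) := by
    rcases han.is_constant_or_isOpen hUc with ⟨w, hw⟩ | h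
    · intro s hs hso
      rcases s.eq_empty_or_nonempty with rfl | ⟨z, hz⟩
      · simp
      · obtain ⟨y, hy, hne⟩ := hnc z (hs hz) univ univ_mem
        exact absurd ((hw y hy.2).trans (hw z (hs hz)).symm) hne
    · exact h
  set h := Function.invFunOn g U with hh
  have hleft : ∀ z ∈ U, h (g z) = z := fun z hz => hinj.leftInvOn_invFunOn hz
  have hcont : ∀ z ∈ U, ContinuousAt h (g z) := by
    intro z hz
    rw [ContinuousAt, hleft z hz]
    intro V hV
    have h1 : V ∩ U ∈ 𝓝 z := inter_mem hV (hU.mem_nhds hz)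
    obtain ⟨W, hWs, hWo, hzW⟩ := _root_.mem_nhds_iff.1 h1
    have h2 := (hop W (fun x hx => (hWs hx).2) hWo).mem_nhds (mem_image_of_mem g hzW)
    rw [mem_map]
    filter_upwards [h2]
    rintro _ ⟨y, hy, rfl⟩
    rw [mem_preimage, hleft y (hWs hy).2]
    exact (hWs hy).1
  have hright : ∀ z ∈ U, ∀ᶠ y in 𝓝 (g z), g (h y) = y := by
    intro z hz
    filter_upwards [(hop U subset_rfl hU).mem_nhds (mem_image_of_mem g hz)]
    rintro _ ⟨y, hy, rfl⟩
    rw [hleft y hy]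
  have hder : ∀ z ∈ U, HasDerivAt g (deriv g z) z := fun z hz =>
    (han z hz).differentiableAt.hasDerivAt
  have hd0 : ∀ z ∈ U, deriv g z ≠ 0 → DifferentiableAt ℂ h (g z) := by
    intro z hz hne
    have := HasDerivAt.of_local_left_inverse (f := g) (g := h) (a := g z) (hcont z hz)
      (by rw [hleft z hz]; exact hder z hz) hne (hright z hz)
    exact this.differentiableAt
  have hd1 : ∀ z ∈ U, DifferentiableAt ℂ h (g z) := by
    intro z hz
    have han' : AnalyticAt ℂ (deriv g) z := (han z hz).deriv
    -- Either `g'` vanishes near `z`, making `g` locally constant against injectivity, or `z` is at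
    -- worst an isolated critical point. Then `h` is continuous at `g z` and holomorphic around it,
    -- so the singularity is removable.
    rcases han'.eventually_eq_zero_or_eventually_ne_zero with h0 | h0
    · exfalso
      obtain ⟨ε, hε, hb⟩ := Metric.mem_nhds_iff.1 (inter_mem h0 (hU.mem_nhds hz))
      obtain ⟨y, hy, hne⟩ := hnc z hz (ball z ε) (ball_mem_nhds z hε)
      refine hne ((convex_ball z ε).is_const_of_fderivWithin_eq_zero (𝕜 := ℂ)
        (fun x hx => (han x (hb hx).2).differentiableAt.differentiableWithinAt) ?_ hy.1
        (mem_ball_self hε))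
      intro x hx
      rw [fderivWithin_of_isOpen isOpen_ball hx]
      ext
      have : deriv g x = 0 := (hb hx).1
      simp [this]
    · refine (Complex.analyticAt_of_differentiable_on_punctured_nhds_of_continuousAt ?_
        (hcont z hz)).differentiableAt
      rw [eventually_nhdsWithin_iff] at h0 ⊢
      obtain ⟨W, hWs, hWo, hzW⟩ := _root_.mem_nhds_iff.1 (inter_mem h0 (hU.mem_nhds hz))
      filter_upwards [(hop W (fun x hx => (hWs hx).2) hWo).mem_nhds (mem_image_of_mem g hzW)]
      rintro _ ⟨y, hy, rfl⟩ hyz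
      exact hd0 y (hWs hy).2 ((hWs hy).1 (fun h => hyz (by rw [h]; rfl)))
  refine ⟨hop U subset_rfl hU, ?_, h, ?_, hleft⟩
  · intro z hz h0
    have h1 : HasDerivAt (h ∘ g) (deriv h (g z) * deriv g z) z :=
      (hd1 z hz).hasDerivAt.comp z (hder z hz)
    have h2 : HasDerivAt (h ∘ g) 1 z :=
      (hasDerivAt_id z).congr_of_eventuallyEq
        (by filter_upwards [hU.mem_nhds hz] with y hy using hleft y hy)
    have := h1.unique h2
    simp [h0] at this
  · rintro _ ⟨z, hz, rfl⟩
    exact (hd1 z hz).differentiableWithinAt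

/-- A holomorphic function whose values lie in the image of a univalent function factors
through it. -/
theorem Set.InjOn.exists_holomorphic_lift {g φ : ℂ → ℂ} (hg : DifferentiableOn ℂ g (ball 0 1))
    (hinj : InjOn g (ball 0 1)) (hφ : DifferentiableOn ℂ φ (ball 0 1))
    (hmaps : MapsTo φ (ball 0 1) (g '' ball 0 1)) :
    ∃ v : ℂ → ℂ, DifferentiableOn ℂ v (ball 0 1) ∧ MapsTo v (ball 0 1) (ball 0 1) ∧
      ∀ z ∈ ball (0 : ℂ) 1, g (v z) = φ z := by
  obtain ⟨-, -, h, hh, hleft⟩ := hinj.exists_holomorphic_inverse isOpen_ball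
    (convex_ball 0 1).isPreconnected hg
  refine ⟨h ∘ φ, hh.comp hφ hmaps, ?_, ?_⟩ <;> intro z hz <;> obtain ⟨y, hy, hyz⟩ := hmaps hz
  · simpa [← hyz, hleft y hy] using hy
  · simp [← hyz, hleft y hy]

/-- Subordination: if `φ` has values in the image of a univalent `g` and `φ 0 = g 0`, then
every value `φ z` is attained by `g` in the closed disc of radius `‖z‖`. -/
theorem Set.InjOn.exists_norm_le_of_subordinate {g φ : ℂ → ℂ}
    (hg : DifferentiableOn ℂ g (ball 0 1)) (hinj : InjOn g (ball 0 1))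
    (hφ : DifferentiableOn ℂ φ (ball 0 1)) (hmaps : MapsTo φ (ball 0 1) (g '' ball 0 1))
    (h0 : φ 0 = g 0) {z : ℂ} (hz : z ∈ ball (0 : ℂ) 1) :
    ∃ y ∈ ball (0 : ℂ) 1, ‖y‖ ≤ ‖z‖ ∧ g y = φ z := by
  obtain ⟨v, hv, hvm, hgv⟩ := hinj.exists_holomorphic_lift hg hφ hmaps
  have h1 : (0 : ℂ) ∈ ball (0 : ℂ) 1 := mem_ball_self one_pos
  have hv0 : v 0 = 0 := hinj (hvm h1) h1 (by rw [hgv 0 h1, h0])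
  exact ⟨v z, hvm hz, Complex.norm_le_norm_of_mapsTo_ball hv (hvm.mono_right ball_subset_closedBall)
    hv0 (by simpa using hz), hgv z hz⟩

theorem IsConvexFunction.deriv_ne_zero {g : ℂ → ℂ} (hg : IsConvexFunction g) {z : ℂ}
    (hz : z ∈ ball (0 : ℂ) 1) : deriv g z ≠ 0 :=
  (hg.2.1.exists_holomorphic_inverse isOpen_ball (convex_ball 0 1).isPreconnected hg.1).2.1 z hz

/-! ### Averaging over roots of unity and Rogosinski's coefficient bound -/

theorem IsPrimitiveRoot.sum_pow_mul_eq_zero {ω : ℂ} {n k : ℕ} (hω : IsPrimitiveRoot ω n)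
    (hk : 0 < k) (hkn : k < n) : ∑ j ∈ Finset.range n, (ω ^ j) ^ k = 0 := by
  have h1 : ω ^ k ≠ 1 := hω.pow_ne_one_of_pos_of_lt hk.ne' hkn
  have h2 : ∑ j ∈ Finset.range n, (ω ^ k) ^ j = 0 := by
    rw [geom_sum_eq h1, ← pow_mul, mul_comm k n, pow_mul, hω.pow_eq_one]
    simp
  rw [← h2]
  exact Finset.sum_congr rfl fun j _ => by rw [← pow_mul, ← pow_mul, mul_comm]

theorem AnalyticAt.isBigO_sub_sum_taylorCoeff {φ : ℂ → ℂ} (hφ : AnalyticAt ℂ φ 0) (n : ℕ) :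
    (fun z => φ z - ∑ k ∈ Finset.range n, taylorCoeff φ k * z ^ k) =O[𝓝 0]
      fun z => ‖z‖ ^ n := by
  have := hφ.hasFPowerSeriesAt.isBigO_sub_partialSum_pow n
  refine this.congr_left fun z => ?_
  simp [FormalMultilinearSeries.partialSum, taylorCoeff, mul_comm]

/-- Averaging over the `n`-th roots of unity leaves only the constant term and the term of
degree `n` of the Taylor polynomial of degree `n`. -/
theorem AnalyticAt.isBigO_average_rootsOfUnity {φ : ℂ → ℂ} (hφ : AnalyticAt ℂ φ 0) {n : ℕ}
    (hn : 1 ≤ n) {ω : ℂ} (hω : IsPrimitiveRoot ω n) :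
    (fun z => ∑ j ∈ Finset.range n, ((n : ℝ)⁻¹) • φ (ω ^ j * z)
      - φ 0 - taylorCoeff φ n * z ^ n) =O[𝓝 0] fun z => ‖z‖ ^ (n + 1) := by
  have hnC : (n : ℂ) ≠ 0 := by exact_mod_cast (by omega : n ≠ 0)
  have hωn : ‖ω‖ = 1 := hω.norm'_eq_one (by omega)
  have h1 : ∀ j ∈ Finset.range n, (fun z => ((n : ℝ)⁻¹) • (φ (ω ^ j * z)
      - ∑ k ∈ Finset.range (n + 1), taylorCoeff φ k * (ω ^ j * z) ^ k)) =O[𝓝 0]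
        fun z => ‖z‖ ^ (n + 1) := by
    intro j _
    have ht : Tendsto (fun z : ℂ => ω ^ j * z) (𝓝 0) (𝓝 0) := by
      simpa using (by fun_prop : Continuous fun z : ℂ => ω ^ j * z).tendsto 0
    have := ((hφ.isBigO_sub_sum_taylorCoeff (n + 1)).comp_tendsto ht).const_smul_left ((n : ℝ)⁻¹)
    refine this.trans ?_
    simp only [Function.comp_def, norm_mul, norm_pow, hωn, one_pow, one_mul]
    exact Asymptotics.isBigO_refl _ _
  refine (Asymptotics.IsBigO.sum h1).congr_left fun z => ?_
  have h2 : ∑ j ∈ Finset.range n, ((n : ℝ)⁻¹) •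
      ∑ k ∈ Finset.range (n + 1), taylorCoeff φ k * (ω ^ j * z) ^ k
      = φ 0 + taylorCoeff φ n * z ^ n := by
    have h3 : ∀ k, ∑ j ∈ Finset.range n, taylorCoeff φ k * (ω ^ j * z) ^ k
        = taylorCoeff φ k * z ^ k * ∑ j ∈ Finset.range n, (ω ^ j) ^ k := by
      intro k
      rw [Finset.mul_sum]
      exact Finset.sum_congr rfl fun j _ => by rw [mul_pow]; ring
    rw [← Finset.smul_sum, Finset.sum_comm, Finset.sum_congr rfl fun k _ => h3 k]
    rw [Finset.sum_range_succ, Finset.sum_eq_single 0]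
    · have h4 : ∑ j ∈ Finset.range n, (ω ^ j) ^ n = n := by
        rw [Finset.sum_congr rfl fun j _ => by
          rw [← pow_mul, mul_comm, pow_mul, hω.pow_eq_one, one_pow]]
        simp
      rw [h4]
      simp only [taylorCoeff, iteratedDeriv_zero, Nat.factorial_zero, Nat.cast_one, div_one,
        pow_zero, mul_one, Finset.sum_const, Finset.card_range, nsmul_eq_mul, Complex.real_smul,
        Complex.ofReal_inv, Complex.ofReal_natCast]
      field_simp
    · intro k hk hk0
      rw [hω.sum_pow_mul_eq_zero (by omega) (Finset.mem_range.1 hk), mul_zero]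
    · intro h
      exact absurd (Finset.mem_range.2 (by omega)) h
  simp only [Finset.sum_apply, smul_sub, Finset.sum_sub_distrib]
  rw [h2]
  ring

/-- Rogosinski's theorem: a function subordinate to a convex function `g` has all its Taylor
coefficients of positive degree bounded by `|g'(0)|`. -/
theorem IsConvexFunction.norm_taylorCoeff_le {g φ : ℂ → ℂ} (hg : IsConvexFunction g)
    (hφ : DifferentiableOn ℂ φ (ball 0 1)) (hmaps : MapsTo φ (ball 0 1) (g '' ball 0 1))
    (h0 : φ 0 = g 0) {n : ℕ} (hn : 1 ≤ n) : ‖taylorCoeff φ n‖ ≤ ‖deriv g 0‖ := by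
  have h01 : (0 : ℂ) ∈ ball (0 : ℂ) 1 := mem_ball_self one_pos
  have hω := Complex.isPrimitiveRoot_exp n (by omega)
  set ω := Complex.exp (2 * Real.pi * Complex.I / n)
  have hωn : ‖ω‖ = 1 := hω.norm'_eq_one (by omega)
  have hrot : ∀ j, MapsTo (fun z : ℂ => ω ^ j * z) (ball 0 1) (ball 0 1) := by
    intro j z hz
    simpa [hωn] using hz
  have hφ0 : AnalyticAt ℂ φ 0 := hφ.analyticAt (isOpen_ball.mem_nhds h01)
  have hasy := hφ0.isBigO_average_rootsOfUnity hn hω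
  -- Convexity keeps this average inside the image of `g`, while the average kills the terms of
  -- degree strictly between 0 and `n`. Its lift `v` through `g` therefore vanishes to order `n` at
  -- 0.
  set ψ : ℂ → ℂ := fun z => ∑ j ∈ Finset.range n, ((n : ℝ)⁻¹) • φ (ω ^ j * z) with hψdef
  have hψ0 : ψ 0 = φ 0 := by
    have : (n : ℂ) ≠ 0 := by exact_mod_cast (by omega : n ≠ 0)
    simp [hψdef, this]
  have hψd : DifferentiableOn ℂ ψ (ball 0 1) := by
    refine DifferentiableOn.fun_sum fun j _ => DifferentiableOn.fun_const_smul ?_ _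
    exact hφ.comp ((differentiable_const _).mul differentiable_id).differentiableOn (hrot j)
  have hψm : MapsTo ψ (ball 0 1) (g '' ball 0 1) := by
    intro z hz
    refine hg.2.2.sum_mem (fun _ _ => by positivity) ?_ (fun j _ => hmaps (hrot j hz))
    have : (n : ℝ) ≠ 0 := by exact_mod_cast (by omega : n ≠ 0)
    simp [this]
  obtain ⟨v, hv, hvm, hgv⟩ := hg.2.1.exists_holomorphic_lift hg.1 hψd hψm
  have hv0 : v 0 = 0 := hg.2.1 (hvm h01) h01 (by rw [hgv 0 h01, hψ0, h0])
  have hnhds : ball (0 : ℂ) 1 ∈ 𝓝 0 := isOpen_ball.mem_nhds h01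
  set m := dslope g 0 with hm
  have hgm : ∀ z ∈ ball (0 : ℂ) 1, ψ z - φ 0 = v z * m (v z) := by
    intro z hz
    rw [← hgv z hz, h0]
    have := sub_smul_dslope g 0 (v z)
    simpa using this.symm
  have hmc : ContinuousAt m 0 :=
    continuousAt_dslope_same.2 (hg.1.differentiableAt hnhds)
  have hvc : Tendsto v (𝓝 0) (𝓝 0) := by
    have := (hv.differentiableAt hnhds).continuousAt.tendsto
    rwa [hv0] at this
  have hmv : Tendsto (fun z => ‖m (v z)‖) (𝓝 0) (𝓝 ‖deriv g 0‖) := by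
    have := (hmc.tendsto.comp hvc).norm
    simpa [hm] using this
  have hd0 : 0 < ‖deriv g 0‖ := norm_pos_iff.2 (hg.deriv_ne_zero h01)
  have hψO : (fun z => ψ z - φ 0) =O[𝓝 0] fun z => ‖z‖ ^ n := by
    have h1 : (fun z : ℂ => taylorCoeff φ n * z ^ n) =O[𝓝 0] fun z => ‖z‖ ^ n := by
      refine Asymptotics.IsBigO.const_mul_left ?_ _
      exact Asymptotics.IsBigO.of_norm_left (by simpa using Asymptotics.isBigO_refl _ _)
    have h2 : (fun z : ℂ => ‖z‖ ^ (n + 1)) =O[𝓝 0] fun z => ‖z‖ ^ n := by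
      refine Asymptotics.IsBigO.of_bound 1 ?_
      filter_upwards [hnhds] with z hz
      have : ‖z‖ ≤ 1 := by simpa using (mem_ball.1 hz).le
      simp only [norm_pow, norm_norm, one_mul]
      exact pow_le_pow_of_le_one (norm_nonneg _) this (by omega)
    exact ((hasy.trans h2).add h1).congr_left fun z => by ring
  have hvO : v =O[𝓝 0] fun z => ‖z‖ ^ n := by
    refine Asymptotics.IsBigO.trans ?_ hψO
    refine Asymptotics.IsBigO.of_bound (2 / ‖deriv g 0‖) ?_
    filter_upwards [hnhds, hmv.eventually (lt_mem_nhds (half_lt_self hd0))] with z hz hz2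
    rw [hgm z hz, norm_mul]
    have : ‖v z‖ * (‖deriv g 0‖ / 2) ≤ ‖v z‖ * ‖m (v z)‖ := by gcongr
    calc ‖v z‖ = 2 / ‖deriv g 0‖ * (‖v z‖ * (‖deriv g 0‖ / 2)) := by field_simp
      _ ≤ _ := by gcongr
  -- Schwarz lemma of order `n`; it takes `v = o(‖z‖ ^ (n - 1))` as input.
  have hvb : ∀ z ∈ ball (0 : ℂ) 1, ‖v z‖ ≤ ‖z‖ ^ n := by
    intro z hz
    have ho : (v · - v 0) =o[𝓝 0] fun w : ℂ => ‖w - 0‖ ^ (n - 1) := by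
      simp only [hv0, sub_zero]
      refine hvO.trans_isLittleO ?_
      have : (fun z : ℂ => ‖z‖ ^ n) = fun z : ℂ => ‖z‖ ^ (n - 1) * ‖z‖ := by
        ext z; rw [← pow_succ]; congr 1; omega
      rw [this]
      have h3 : (fun z : ℂ => ‖z‖) =o[𝓝 0] fun _ : ℂ => (1 : ℝ) := by
        rw [Asymptotics.isLittleO_one_iff]
        simpa using (continuous_norm : Continuous fun z : ℂ => ‖z‖).tendsto 0
      simpa using (Asymptotics.isBigO_refl (fun z : ℂ => ‖z‖ ^ (n - 1)) (𝓝 0)).mul_isLittleO h3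
    have := Complex.dist_le_mul_div_pow_of_mapsTo_ball_of_isLittleO (R₂ := 1) hv
      (by rw [hv0]; exact hvm.mono_right ball_subset_closedBall) ho hz
    simpa [hv0, Nat.sub_add_cancel hn] using this
  have hlim : Tendsto (fun z => ‖(ψ z - φ 0) / z ^ n‖) (𝓝[≠] 0) (𝓝 ‖taylorCoeff φ n‖) := by
    refine Tendsto.norm ?_
    obtain ⟨C, hC⟩ := hasy.bound
    rw [tendsto_iff_norm_sub_tendsto_zero]
    refine squeeze_zero' (Eventually.of_forall fun _ => norm_nonneg _)
      (g := fun z : ℂ => C * ‖z‖) ?_ ?_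
    · filter_upwards [mem_nhdsWithin_of_mem_nhds hC, self_mem_nhdsWithin] with z hz hz0
      have hz0' : z ≠ 0 := hz0
      have e1 : (ψ z - φ 0) / z ^ n - taylorCoeff φ n
          = (ψ z - φ 0 - taylorCoeff φ n * z ^ n) / z ^ n := by field_simp
      rw [e1, norm_div, div_le_iff₀ (norm_pos_iff.2 (pow_ne_zero n hz0'))]
      refine hz.trans (le_of_eq ?_)
      simp [pow_succ]; ring
    · refine tendsto_nhdsWithin_of_tendsto_nhds ?_
      simpa using (by fun_prop : Continuous fun z : ℂ => C * ‖z‖).tendsto 0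
  -- Divide `ψ - φ 0 = v · m(v)` by `z ^ n`: the left side tends to the coefficient, and the right
  -- side is at most `‖m (v z)‖`, which tends to `‖g'(0)‖`.
  refine le_of_tendsto_of_tendsto hlim (tendsto_nhdsWithin_of_tendsto_nhds hmv) ?_
  filter_upwards [mem_nhdsWithin_of_mem_nhds hnhds, self_mem_nhdsWithin] with z hz hz0
  have hz0' : z ≠ 0 := hz0
  rw [norm_div, div_le_iff₀ (norm_pos_iff.2 (pow_ne_zero n hz0')), hgm z hz, norm_mul, norm_pow, mul_comm]
  gcongr
  exact hvb z hz

/-! ### Convex functions are starlike of order one half -/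

theorem HasDerivAt.nonpos_of_le_right {u : ℝ → ℝ} {u' a : ℝ} (hu : HasDerivAt u u' a)
    (h : ∀ᶠ t in 𝓝[>] a, u t ≤ u a) : u' ≤ 0 := by
  have h1 := (hasDerivWithinAt_iff_tendsto_slope' (self_notMem_Ioi)).1
    (hu.hasDerivWithinAt (s := Ioi a))
  refine le_of_tendsto h1 ?_
  filter_upwards [h, self_mem_nhdsWithin] with t ht hta
  rw [slope_def_field]
  exact div_nonpos_of_nonpos_of_nonneg (sub_nonpos.2 ht) (sub_nonneg.2 (le_of_lt hta))

theorem HasDerivAt.normSq_comp {c : ℝ → ℂ} {c' : ℂ} {t : ℝ} (hc : HasDerivAt c c' t) :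
    HasDerivAt (fun s => ‖c s‖ ^ 2) (2 * ((starRingEnd ℂ) (c t) * c').re) t := by
  have := hc.norm_sq
  simpa [Complex.inner, mul_comm] using this

namespace IsConvexFunction

variable {g : ℂ → ℂ}

/-- Infinitesimal form of the convexity of the images of concentric discs. -/
theorem re_div_nonneg (hg : IsConvexFunction g) {z x : ℂ}
    (hz : z ∈ ball (0 : ℂ) 1) (hx : ‖x‖ ≤ 1) :
    0 ≤ ((g z - g (x * z)) / (z * deriv g z)).re := by
  obtain ⟨hop, hne, h, hh, hleft⟩ := hg.2.1.exists_holomorphic_inverse isOpen_ball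
    (convex_ball 0 1).isPreconnected hg.1
  have hmx : MapsTo (fun y : ℂ => x * y) (ball 0 1) (ball 0 1) := by
    intro y hy
    rw [mem_ball_zero_iff] at hy ⊢
    rw [norm_mul]
    nlinarith [norm_nonneg x, norm_nonneg y]
  have hgd : HasDerivAt g (deriv g z) z :=
    (hg.1.differentiableAt (isOpen_ball.mem_nhds hz)).hasDerivAt
  have hhd : HasDerivAt h (deriv g z)⁻¹ (g z) := by
    have h1 : HasDerivAt h (deriv h (g z)) (g z) :=
      (hh.differentiableAt (hop.mem_nhds (mem_image_of_mem g hz))).hasDerivAt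
    have h2 : HasDerivAt (h ∘ g) (deriv h (g z) * deriv g z) z := h1.comp z hgd
    have h3 : HasDerivAt (h ∘ g) 1 z := (hasDerivAt_id z).congr_of_eventuallyEq
      (by filter_upwards [isOpen_ball.mem_nhds hz] with y hy using hleft y hy)
    rwa [← eq_inv_of_mul_eq_one_left (h2.unique h3)]
  -- Pull the segment from `g z` to `g (x * z)` back to the disc. For fixed `τ`, `y ↦ (1-τ) g(y) + τ
  -- g(xy)` is subordinate to `g`, so `‖c τ‖ ≤ ‖z‖`; the sign of the derivative of `‖c‖²` at 0 is
  -- the claim.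
  set c : ℝ → ℂ := fun τ => h (g z + τ * (g (x * z) - g z)) with hc
  have hcd : HasDerivAt c ((deriv g z)⁻¹ * (g (x * z) - g z)) 0 := by
    have h1 : HasDerivAt (fun τ : ℝ => g z + (τ : ℂ) * (g (x * z) - g z))
        (g (x * z) - g z) 0 := by
      simpa using ((Complex.ofRealCLM.hasDerivAt (x := (0 : ℝ))).mul_const
        (g (x * z) - g z)).const_add (g z)
    exact HasDerivAt.comp (h₂ := h) (0 : ℝ) (by simpa using hhd) h1
  have hle : ∀ᶠ τ in 𝓝[>] (0 : ℝ), ‖c τ‖ ^ 2 ≤ ‖c 0‖ ^ 2 := by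
    filter_upwards [Ioo_mem_nhdsGT (zero_lt_one' ℝ)] with τ hτ
    have hφ : DifferentiableOn ℂ (fun y => g y + (τ : ℂ) * (g (x * y) - g y)) (ball 0 1) := by
      have h1 : DifferentiableOn ℂ (fun y => g (x * y)) (ball 0 1) :=
        hg.1.comp ((differentiable_const x).mul differentiable_id).differentiableOn hmx
      exact hg.1.fun_add ((h1.fun_sub hg.1).const_mul _)
    have hmaps : MapsTo (fun y => g y + (τ : ℂ) * (g (x * y) - g y)) (ball 0 1)
        (g '' ball 0 1) := by
      intro y hy
      have := hg.2.2 (mem_image_of_mem g hy) (mem_image_of_mem g (hmx hy))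
        (sub_nonneg.2 hτ.2.le) hτ.1.le (by ring)
      convert this using 1
      simp only [Complex.real_smul, Complex.ofReal_sub, Complex.ofReal_one]
      ring
    obtain ⟨y, hy, hyz, hgy⟩ := hg.2.1.exists_norm_le_of_subordinate hg.1 hφ hmaps
      (by simp) hz
    have e1 : c τ = y := by rw [hc]; simp only; rw [← hgy, hleft y hy]
    have e2 : c 0 = z := by simp [hc, hleft z hz]
    rw [e1, e2]
    gcongr
  have h1 := hcd.normSq_comp.nonpos_of_le_right hle
  have e2 : c 0 = z := by simp [hc, hleft z hz]
  rw [e2] at h1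
  rcases eq_or_ne z 0 with rfl | hz0
  · simp
  have e3 : (g z - g (x * z)) / (z * deriv g z)
      = ((-(‖z‖ ^ 2)⁻¹ : ℝ) : ℂ) *
        ((starRingEnd ℂ) z * ((deriv g z)⁻¹ * (g (x * z) - g z))) := by
    have e4 : (starRingEnd ℂ) z = (‖z‖ ^ 2 : ℝ) / z := by
      rw [eq_div_iff hz0, mul_comm, Complex.mul_conj, Complex.normSq_eq_norm_sq]
    have e5 : ((‖z‖ : ℝ) : ℂ) ≠ 0 := by simpa using hz0
    rw [e4]
    push_cast
    field_simp [hne z hz]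
    ring
  rw [e3, Complex.re_ofReal_mul]
  have : 0 ≤ (‖z‖ ^ 2)⁻¹ := by positivity
  nlinarith

/-- A convex function is starlike of order one half. -/
theorem half_le_re (hg : IsConvexFunction g) (h0 : g 0 = 0) {z : ℂ}
    (hz : z ∈ ball (0 : ℂ) 1) (hz0 : z ≠ 0) : 1 / 2 ≤ (z * deriv g z / g z).re := by
  have hzn : 0 < ‖z‖ := norm_pos_iff.2 hz0
  have hz1 : ‖z‖ < 1 := by simpa using hz
  set R := ‖z‖⁻¹ with hR
  have hR1 : 1 < R := (one_lt_inv₀ hzn).2 hz1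
  set B : Set ℂ := ball 0 R with hB
  have hBo : IsOpen B := isOpen_ball
  have h1B : (1 : ℂ) ∈ B := by simpa [hB] using hR1
  have hmx : ∀ x ∈ B, x * z ∈ ball (0 : ℂ) 1 := by
    intro x hx
    rw [hB, mem_ball_zero_iff] at hx
    rw [mem_ball_zero_iff, norm_mul, ← inv_mul_cancel₀ hzn.ne', ← hR]
    gcongr
  set k : ℂ → ℂ := fun x => g (x * z) with hk
  have hkd : DifferentiableOn ℂ k B :=
    hg.1.comp (differentiable_id.mul (differentiable_const z)).differentiableOn hmx
  have hk1 : deriv k 1 = z * deriv g z := by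
    have h1 : HasDerivAt g (deriv g z) (1 * z) := by
      rw [one_mul]
      exact (hg.1.differentiableAt (isOpen_ball.mem_nhds hz)).hasDerivAt
    have h2 : HasDerivAt (fun x : ℂ => x * z) z 1 := by
      simpa using (hasDerivAt_id (1 : ℂ)).mul_const z
    rw [mul_comm]
    exact (h1.comp (1 : ℂ) h2).deriv
  set D1 := dslope k 1 with hD1
  set D2 := dslope D1 1 with hD2
  have hD1d : DifferentiableOn ℂ D1 B :=
    (Complex.differentiableOn_dslope (hBo.mem_nhds h1B)).2 hkd
  have hD2d : DifferentiableOn ℂ D2 B :=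
    (Complex.differentiableOn_dslope (hBo.mem_nhds h1B)).2 hD1d
  have hD1x : ∀ x, x ≠ 1 → (1 - x) * D1 x = g z - g (x * z) := by
    intro x hx
    have := sub_smul_dslope k 1 x
    simp only [hk, one_mul, smul_eq_mul] at this
    linear_combination -this
  have hD1ne : ∀ x ∈ B, D1 x ≠ 0 := by
    intro x hx
    rcases eq_or_ne x 1 with rfl | hx1
    · rw [hD1, dslope_same, hk1]
      exact mul_ne_zero hz0 (hg.deriv_ne_zero hz)
    · intro h
      have h2 := hD1x x hx1
      rw [h, mul_zero] at h2
      have h3 := hg.2.1 hz (hmx x hx) (sub_eq_zero.1 h2.symm)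
      exact hx1 (mul_right_cancel₀ hz0 (by rw [← h3, one_mul]))
  -- Away from 1, `H(x) = z g'(z)/(g(z) - g(xz)) - 1/(1-x)`, with the poles at 1 cancelled. On the
  -- unit circle the first term has nonnegative real part and `Re 1/(1-x) = 1/2`, so `Re H ≥ -1/2`
  -- there; the value `H(0) = z g'(z)/g(z) - 1` inherits this.
  set H : ℂ → ℂ := fun x => D2 x / D1 x with hH
  have hHd : DifferentiableOn ℂ H B := hD2d.div hD1d hD1ne
  have hHx : ∀ x ∈ B, x ≠ 1 → H x = ((g z - g (x * z)) / (z * deriv g z))⁻¹ - (1 - x)⁻¹ := by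
    intro x hx hx1
    have h2 : (1 - x) * D2 x = z * deriv g z - D1 x := by
      have := sub_smul_dslope D1 1 x
      rw [smul_eq_mul, show D1 1 = z * deriv g z by rw [hD1, dslope_same, hk1]] at this
      linear_combination -this
    have h3 : (1 - x) ≠ 0 := sub_ne_zero.2 hx1.symm
    rw [inv_div, ← hD1x x hx1, hH]
    field_simp [hD1ne x hx]
    linear_combination h2
  have hcl : closedBall (0 : ℂ) 1 ⊆ B := closedBall_subset_ball hR1
  have hsph : ∀ x ∈ sphere (0 : ℂ) 1, x ≠ 1 → -(1 / 2) ≤ (H x).re := by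
    intro x hx hx1
    rw [hHx x (hcl (sphere_subset_closedBall hx)) hx1, Complex.sub_re]
    have hxn : ‖x‖ = 1 := by simpa using hx
    have h1 := hg.re_div_nonneg hz hxn.le
    have h2 : 0 ≤ (((g z - g (x * z)) / (z * deriv g z))⁻¹).re := by
      rw [Complex.inv_re]; exact div_nonneg h1 (Complex.normSq_nonneg _)
    have h3 : ((1 - x)⁻¹).re = 1 / 2 := by
      have h4 : Complex.normSq (1 - x) ≠ 0 := by simpa [sub_eq_zero] using hx1.symm
      have h5 : Complex.normSq x = 1 := by rw [Complex.normSq_eq_norm_sq, hxn]; norm_num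
      rw [Complex.inv_re, div_eq_div_iff h4 two_ne_zero]
      rw [Complex.normSq_apply] at h5 ⊢
      simp only [Complex.sub_re, Complex.one_re, Complex.sub_im, Complex.one_im]
      nlinarith
    linarith
  have hsph1 : -(1 / 2) ≤ (H 1).re := by
    have ht : Tendsto (fun t : ℝ => (H (Complex.exp (t * Complex.I))).re) (𝓝[>] 0)
        (𝓝 (H 1).re) := by
      have h1 : ContinuousAt H 1 := (hHd.differentiableAt (hBo.mem_nhds h1B)).continuousAt
      have h2 : Tendsto (fun t : ℝ => Complex.exp (t * Complex.I)) (𝓝 0) (𝓝 1) := by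
        have : Continuous fun t : ℝ => Complex.exp (t * Complex.I) := by fun_prop
        simpa using this.tendsto 0
      exact (Complex.continuous_re.tendsto _).comp
        (h1.tendsto.comp (tendsto_nhdsWithin_of_tendsto_nhds h2))
    refine ge_of_tendsto ht ?_
    filter_upwards [Ioo_mem_nhdsGT (zero_lt_one' ℝ)] with t ht
    refine hsph _ (by simp [Complex.norm_exp_ofReal_mul_I]) fun h => ?_
    have h2 := congrArg Complex.im h
    rw [Complex.exp_ofReal_mul_I_im, Complex.one_im] at h2
    exact (Real.sin_pos_of_pos_of_lt_pi ht.1 (by linarith [ht.2, Real.pi_gt_three])).ne' h2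
  -- The minimum principle for `Re H`, as the maximum modulus principle for `exp (-H)`.
  have hmax : ‖Complex.exp (-H 0)‖ ≤ Real.exp (1 / 2) := by
    have hd : DiffContOnCl ℂ (fun x => Complex.exp (-H x)) (ball 0 1) := by
      refine DifferentiableOn.diffContOnCl ?_
      rw [closure_ball _ one_ne_zero]
      exact (hHd.mono hcl).fun_neg.cexp
    refine Complex.norm_le_of_forall_mem_frontier_norm_le isBounded_ball hd ?_
      (subset_closure (mem_ball_self one_pos))
    intro x hx
    rw [frontier_ball _ one_ne_zero] at hx
    rw [Complex.norm_exp, Complex.neg_re]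
    refine Real.exp_le_exp.2 ?_
    rcases eq_or_ne x 1 with rfl | hx1
    · linarith
    · linarith [hsph x hx hx1]
  rw [Complex.norm_exp, Complex.neg_re, Real.exp_le_exp,
    hHx 0 (hcl (mem_closedBall_self zero_le_one)) zero_ne_one] at hmax
  simp only [zero_mul, h0, sub_zero, inv_div, inv_one, Complex.sub_re, Complex.one_re] at hmax
  linarith

end IsConvexFunction

/-! ### Schwarz and Harnack estimates in a half-plane; growth of `g(z)/z` -/

/-- The point `-ā` is the reflection of `a` in the imaginary axis; the squares differ by `4 Re q Re
a`. -/
theorem Complex.norm_sub_le_norm_add_conj {q a : ℂ} (hq : 0 ≤ q.re) (ha : 0 ≤ a.re) :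
    ‖q - a‖ ≤ ‖q + (starRingEnd ℂ) a‖ := by
  refine le_of_sq_le_sq ?_ (norm_nonneg _)
  rw [← Complex.normSq_eq_norm_sq, ← Complex.normSq_eq_norm_sq, Complex.normSq_apply,
    Complex.normSq_apply]
  simp only [Complex.sub_re, Complex.sub_im, Complex.add_re, Complex.add_im, Complex.conj_re,
    Complex.conj_im]
  nlinarith [mul_nonneg hq ha]

/-- The Schwarz lemma for functions with values in the right half-plane. -/
theorem Complex.norm_sub_le_mul_norm_add_conj {q : ℂ → ℂ} (hq : DifferentiableOn ℂ q (ball 0 1))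
    (hre : ∀ z ∈ ball (0 : ℂ) 1, 0 ≤ (q z).re) (h0 : 0 < (q 0).re) {z : ℂ}
    (hz : z ∈ ball (0 : ℂ) 1) :
    ‖q z - q 0‖ ≤ ‖z‖ * ‖q z + (starRingEnd ℂ) (q 0)‖ := by
  have hne : ∀ y ∈ ball (0 : ℂ) 1, q y + (starRingEnd ℂ) (q 0) ≠ 0 := by
    intro y hy h
    have := congrArg Complex.re h
    simp only [Complex.add_re, Complex.conj_re, Complex.zero_re] at this
    linarith [hre y hy]
  have hd : DifferentiableOn ℂ (fun y => (q y - q 0) / (q y + (starRingEnd ℂ) (q 0)))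
      (ball 0 1) := (hq.sub_const _).fun_div (hq.add_const _) hne
  have := Complex.norm_le_norm_of_mapsTo_ball hd (fun y hy => ?_) (by simp) (by simpa using hz)
  · rwa [norm_div, div_le_iff₀ (norm_pos_iff.2 (hne z hz))] at this
  · rw [mem_closedBall_zero_iff, norm_div]
    exact div_le_one_of_le₀ (norm_sub_le_norm_add_conj (hre y hy) h0.le) (norm_nonneg _)

theorem Complex.norm_mul_one_sub_le_of_re_nonneg {q : ℂ → ℂ}
    (hq : DifferentiableOn ℂ q (ball 0 1)) (hre : ∀ z ∈ ball (0 : ℂ) 1, 0 ≤ (q z).re)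
    (h0 : 0 < (q 0).re) {z : ℂ} (hz : z ∈ ball (0 : ℂ) 1) :
    ‖q 0‖ * (1 - ‖z‖) ≤ ‖q z‖ * (1 + ‖z‖) := by
  have h1 := norm_sub_le_mul_norm_add_conj hq hre h0 hz
  have h2 : ‖q z + (starRingEnd ℂ) (q 0)‖ ≤ ‖q z‖ + ‖q 0‖ := by
    simpa using norm_add_le (q z) ((starRingEnd ℂ) (q 0))
  have h3 : ‖q 0‖ - ‖q z‖ ≤ ‖q z - q 0‖ := by
    rw [norm_sub_rev]; exact norm_sub_norm_le _ _
  nlinarith [norm_nonneg z]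

/-- Harnack's inequality. -/
theorem Complex.one_sub_le_re_mul_of_re_nonneg {q : ℂ → ℂ}
    (hq : DifferentiableOn ℂ q (ball 0 1)) (hre : ∀ z ∈ ball (0 : ℂ) 1, 0 ≤ (q z).re)
    (h0 : q 0 = 1) {z : ℂ} (hz : z ∈ ball (0 : ℂ) 1) :
    1 - ‖z‖ ≤ (q z).re * (1 + ‖z‖) := by
  have h1 := norm_sub_le_mul_norm_add_conj hq hre (by simp [h0]) hz
  rw [h0, map_one] at h1
  have hz1 : ‖z‖ < 1 := by simpa using hz
  have hz0 := norm_nonneg z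
  have h2 : ‖q z - 1‖ ^ 2 ≤ ‖z‖ ^ 2 * ‖q z + 1‖ ^ 2 := by
    rw [← mul_pow]; gcongr
  rw [← Complex.normSq_eq_norm_sq (q z - 1), ← Complex.normSq_eq_norm_sq (q z + 1),
    Complex.normSq_apply, Complex.normSq_apply] at h2
  simp only [Complex.sub_re, Complex.sub_im, Complex.add_re, Complex.add_im, Complex.one_re,
    Complex.one_im, sub_zero, add_zero] at h2
  set x := (q z).re
  set r := ‖z‖
  have hx : 0 ≤ x := hre z hz
  -- The factored form of `(x-1)² ≤ r²(x+1)²`, after discarding the imaginary part. If the claim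
  -- failed, both factors would be negative.
  have h3 : (x * (1 + r) - (1 - r)) * (x * (1 - r) - (1 + r)) ≤ 0 := by
    have : 0 ≤ (q z).im * (q z).im * (1 - r ^ 2) :=
      mul_nonneg (mul_self_nonneg _) (by nlinarith)
    nlinarith
  by_contra! hlt
  have h4 : x * (1 - r) - (1 + r) < 0 := by nlinarith
  nlinarith [mul_pos_of_neg_of_neg (sub_neg.2 hlt) h4]

theorem IsConvexFunction.dslope_ne_zero {g : ℂ → ℂ} (hg : IsConvexFunction g) {z : ℂ}
    (hz : z ∈ ball (0 : ℂ) 1) : dslope g 0 z ≠ 0 := by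
  have h01 : (0 : ℂ) ∈ ball (0 : ℂ) 1 := mem_ball_self one_pos
  rcases eq_or_ne z 0 with rfl | hz0
  · rw [dslope_same]; exact hg.deriv_ne_zero h01
  · rw [dslope_of_ne _ hz0, slope_def_field]
    refine div_ne_zero (sub_ne_zero.2 fun h => hz0 (hg.2.1 hz h01 h)) (by simpa using hz0)

/-- With `u = g(z)/z`, the function `q = 2 z g'/g - 1` has nonnegative real part and `q(0) = 1`.
Harnack then gives `Re (z u'/u) = (Re q - 1)/2 ≥ -r/(1+r)`, which says that `|u|(1+r)` is
nondecreasing along each radius. -/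
theorem IsConvexFunction.norm_deriv_le_norm_dslope {g : ℂ → ℂ} (hg : IsConvexFunction g)
    (h0 : g 0 = 0) {z : ℂ} (hz : z ∈ ball (0 : ℂ) 1) :
    ‖deriv g 0‖ ≤ ‖dslope g 0 z‖ * (1 + ‖z‖) := by
  have h01 : (0 : ℂ) ∈ ball (0 : ℂ) 1 := mem_ball_self one_pos
  set u := dslope g 0 with hu
  have hud : DifferentiableOn ℂ u (ball 0 1) :=
    (Complex.differentiableOn_dslope (isOpen_ball.mem_nhds h01)).2 hg.1
  have hune : ∀ y ∈ ball (0 : ℂ) 1, u y ≠ 0 := fun y hy => IsConvexFunction.dslope_ne_zero hg hy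
  have hgu : ∀ y, g y = y * u y := by
    intro y
    have := sub_smul_dslope g 0 y
    simpa [h0] using this.symm
  have hgd : ∀ y ∈ ball (0 : ℂ) 1, deriv g y = u y + y * deriv u y := by
    intro y hy
    have h1 : HasDerivAt u (deriv u y) y :=
      (hud.differentiableAt (isOpen_ball.mem_nhds hy)).hasDerivAt
    have h2 : HasDerivAt g (1 * u y + y * deriv u y) y := by
      rw [show g = fun y => y * u y from funext hgu]
      exact (hasDerivAt_id y).mul h1
    rw [h2.deriv, one_mul]
  set q : ℂ → ℂ := fun y => 2 * (deriv g y / u y) - 1 with hq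
  have hqd : DifferentiableOn ℂ q (ball 0 1) :=
    (((hg.1.deriv isOpen_ball).fun_div hud hune).const_mul 2).sub_const 1
  have hq0 : q 0 = 1 := by
    have : deriv g 0 ≠ 0 := hg.deriv_ne_zero h01
    simp only [hq, hu, dslope_same, div_self this]; norm_num
  have hqre : ∀ y ∈ ball (0 : ℂ) 1, 0 ≤ (q y).re := by
    intro y hy
    rcases eq_or_ne y 0 with rfl | hy0
    · simp [hq0]
    · have h1 := hg.half_le_re h0 hy hy0
      rw [hgu y, mul_div_mul_left _ _ hy0] at h1
      simp only [hq, Complex.sub_re, Complex.one_re, Complex.mul_re, Complex.re_ofNat,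
        Complex.im_ofNat]
      linarith
  have hdu : ∀ y ∈ ball (0 : ℂ) 1,
      -(‖y‖ * ‖u y‖ ^ 2) ≤ ((starRingEnd ℂ) (u y) * (y * deriv u y)).re * (1 + ‖y‖) := by
    intro y hy
    have h1 := Complex.one_sub_le_re_mul_of_re_nonneg hqd hqre hq0 hy
    have h2 : (starRingEnd ℂ) (u y) * (y * deriv u y) = ((‖u y‖ ^ 2 / 2 : ℝ) : ℂ) * (q y - 1) := by
      have h3 : (starRingEnd ℂ) (u y) = (‖u y‖ ^ 2 : ℝ) / u y := by
        rw [eq_div_iff (hune y hy), mul_comm, Complex.mul_conj, Complex.normSq_eq_norm_sq]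
      rw [h3, hq]
      simp only
      rw [hgd y hy]
      push_cast
      field_simp [hune y hy]
      ring
    rw [h2, Complex.re_ofReal_mul, Complex.sub_re, Complex.one_re]
    nlinarith [sq_nonneg ‖u y‖]
  have hr : ‖z‖ < 1 := by simpa using hz
  have hmem : ∀ t ∈ Icc (0 : ℝ) 1, (t : ℂ) * z ∈ ball (0 : ℂ) 1 := by
    intro t ht
    rw [mem_ball_zero_iff, norm_mul, Complex.norm_real, Real.norm_of_nonneg ht.1]
    nlinarith [norm_nonneg z, ht.1, ht.2]
  have hder : ∀ t ∈ Icc (0 : ℝ) 1, HasDerivAt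
      (fun s : ℝ => ‖u (s * z)‖ ^ 2 * (1 + s * ‖z‖) ^ 2)
      (2 * ((starRingEnd ℂ) (u (t * z)) * (deriv u (t * z) * z)).re * (1 + t * ‖z‖) ^ 2
        + ‖u (t * z)‖ ^ 2 * (2 * (1 + t * ‖z‖) * ‖z‖)) t := by
    intro t ht
    have h1 : HasDerivAt u (deriv u (t * z)) (t * z) :=
      (hud.differentiableAt (isOpen_ball.mem_nhds (hmem t ht))).hasDerivAt
    have h2 : HasDerivAt (fun s : ℝ => (s : ℂ) * z) z t := by
      simpa using (Complex.ofRealCLM.hasDerivAt (x := t)).mul_const z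
    have h3 : HasDerivAt (fun s : ℝ => u (s * z)) (deriv u (t * z) * z) t :=
      HasDerivAt.comp (h₂ := u) t h1 h2
    have h4 : HasDerivAt (fun s : ℝ => (1 + s * ‖z‖) ^ 2) (2 * (1 + t * ‖z‖) * ‖z‖) t := by
      have := (((hasDerivAt_id t).mul_const ‖z‖).const_add 1).fun_pow 2
      simpa using this
    exact h3.normSq_comp.mul h4
  have hmono : MonotoneOn (fun s : ℝ => ‖u (s * z)‖ ^ 2 * (1 + s * ‖z‖) ^ 2) (Icc 0 1) := by
    refine monotoneOn_of_deriv_nonneg (convex_Icc 0 1)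
      (fun t ht => (hder t ht).continuousAt.continuousWithinAt)
      (fun t ht => (hder t (interior_subset ht)).differentiableAt.differentiableWithinAt) ?_
    intro t ht
    rw [interior_Icc] at ht
    rw [(hder t ⟨ht.1.le, ht.2.le⟩).deriv]
    have h1 := hdu _ (hmem t ⟨ht.1.le, ht.2.le⟩)
    rw [show (starRingEnd ℂ) (u (t * z)) * (t * z * deriv u (t * z))
      = (t : ℂ) * ((starRingEnd ℂ) (u (t * z)) * (deriv u (t * z) * z)) by ring,
      Complex.re_ofReal_mul, norm_mul, Complex.norm_real, Real.norm_of_nonneg ht.1.le] at h1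
    set A := ((starRingEnd ℂ) (u (t * z)) * (deriv u (t * z) * z)).re
    have h2 : -(‖z‖ * ‖u (t * z)‖ ^ 2) ≤ A * (1 + t * ‖z‖) := by
      refine le_of_mul_le_mul_left ?_ ht.1
      linarith
    have h3 : 0 ≤ 1 + t * ‖z‖ := by have := ht.1; positivity
    nlinarith
  have h1 := hmono (left_mem_Icc.2 zero_le_one) (right_mem_Icc.2 zero_le_one) zero_le_one
  simp only [Complex.ofReal_zero, zero_mul, add_zero, one_pow, mul_one, Complex.ofReal_one,
    one_mul, ← mul_pow] at h1
  rw [hu, dslope_same] at h1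
  exact le_of_sq_le_sq h1 (by positivity)

/-! ### The half-plane map and Carathéodory's bound -/

/-- The inverse map is `w/(1+w)`, and `|w| < |1+w|` means that `w` is closer to 0 than to `-1`. -/
theorem mem_image_div_one_sub_iff {w : ℂ} :
    w ∈ (fun z : ℂ => z / (1 - z)) '' ball 0 1 ↔ -(1 / 2) < w.re := by
  have key : ∀ w : ℂ, -(1 / 2) < w.re ↔ ‖w‖ < ‖1 + w‖ := by
    intro w
    rw [← sq_lt_sq₀ (norm_nonneg _) (norm_nonneg _), ← Complex.normSq_eq_norm_sq,
      ← Complex.normSq_eq_norm_sq, Complex.normSq_apply, Complex.normSq_apply]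
    simp only [Complex.add_re, Complex.one_re, Complex.add_im, Complex.one_im]
    constructor <;> intro h <;> nlinarith
  constructor
  · rintro ⟨z, hz, rfl⟩
    have hz1 : ‖z‖ < 1 := by simpa using hz
    have hne : 1 - z ≠ 0 := fun h => by
      rw [← sub_eq_zero.1 h] at hz1; simp at hz1
    simp only
    rw [key, show 1 + z / (1 - z) = 1 / (1 - z) by field_simp; ring, norm_div, norm_div, norm_one]
    have := norm_pos_iff.2 hne
    gcongr
  · intro h
    rw [key] at h
    have hne : 1 + w ≠ 0 := norm_pos_iff.1 ((norm_nonneg w).trans_lt h)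
    refine ⟨w / (1 + w), ?_, ?_⟩
    · rw [mem_ball_zero_iff, norm_div, div_lt_one (norm_pos_iff.2 hne)]
      exact h
    · simp only
      rw [show 1 - w / (1 + w) = 1 / (1 + w) by field_simp; ring]
      field_simp

theorem one_sub_ne_zero_of_mem_ball {z : ℂ} (hz : z ∈ ball (0 : ℂ) 1) : 1 - z ≠ 0 := by
  intro h
  rw [← sub_eq_zero.1 h] at hz
  simp at hz

theorem isConvexFunction_div_one_sub : IsConvexFunction fun z : ℂ => z / (1 - z) := by
  refine ⟨?_, ?_, ?_⟩
  · exact differentiableOn_id.fun_div (differentiableOn_id.const_sub 1)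
      fun z hz => one_sub_ne_zero_of_mem_ball hz
  · intro z hz w hw h
    have h1 := one_sub_ne_zero_of_mem_ball hz
    have h2 := one_sub_ne_zero_of_mem_ball hw
    simp only at h
    rw [div_eq_div_iff h1 h2] at h
    linear_combination h
  · have : (fun z : ℂ => z / (1 - z)) '' ball 0 1 = {w : ℂ | -(1 / 2) < w.re} := by
      ext w; exact mem_image_div_one_sub_iff
    rw [this]
    exact convex_halfSpace_re_gt _

theorem hasDerivAt_div_one_sub {z : ℂ} (hz : 1 - z ≠ 0) :
    HasDerivAt (fun z : ℂ => z / (1 - z)) (1 / (1 - z) ^ 2) z := by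
  exact ((hasDerivAt_id z).fun_div ((hasDerivAt_id z).const_sub 1) hz).congr_deriv (by simp)

theorem taylorCoeff_const_mul_sub {q : ℂ → ℂ} (hq : AnalyticAt ℂ q 0) (a b : ℂ) {n : ℕ}
    (hn : 1 ≤ n) : taylorCoeff (fun z => a * (q z - b)) n = a * taylorCoeff q n := by
  obtain ⟨m, rfl⟩ : ∃ m, n = m + 1 := ⟨n - 1, by omega⟩
  have h1 : deriv (fun z => a * (q z - b)) =ᶠ[𝓝 0] fun z => a * deriv q z := by
    filter_upwards [hq.eventually_analyticAt] with z hz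
    rw [deriv_const_mul _ (hz.differentiableAt.sub_const b), deriv_sub_const]
  rw [taylorCoeff, taylorCoeff, iteratedDeriv_succ', iteratedDeriv_succ',
    h1.iteratedDeriv_eq, iteratedDeriv_const_mul_field]
  ring

/-- Carathéodory's coefficient bound for functions with positive real part. -/
theorem norm_taylorCoeff_le_of_re_pos {q : ℂ → ℂ} (hq : DifferentiableOn ℂ q (ball 0 1))
    (hre : ∀ z ∈ ball (0 : ℂ) 1, 0 < (q z).re) {n : ℕ} (hn : 1 ≤ n) :
    ‖taylorCoeff q n‖ ≤ 2 * (q 0).re := by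
  have h01 : (0 : ℂ) ∈ ball (0 : ℂ) 1 := mem_ball_self one_pos
  have ha := hre 0 h01
  -- Subtracting `q(0)` and dividing by `2 Re q(0)` turns the right half-plane into `Re w > -1/2` up
  -- to an imaginary translation, so the result is subordinate to `z/(1-z)`.
  have h1 := isConvexFunction_div_one_sub.norm_taylorCoeff_le
    (φ := fun z => ((2 * (q 0).re : ℝ) : ℂ)⁻¹ * (q z - q 0)) ((hq.sub_const _).const_mul _)
    (fun z hz => ?_) (by simp) hn
  · rw [taylorCoeff_const_mul_sub (hq.analyticAt (isOpen_ball.mem_nhds h01)) _ _ hn,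
      (hasDerivAt_div_one_sub (by simp : (1 : ℂ) - 0 ≠ 0)).deriv, norm_mul, norm_inv,
      Complex.norm_real, Real.norm_of_nonneg (by linarith)] at h1
    rw [inv_mul_le_iff₀ (by linarith)] at h1
    simpa using h1
  · rw [mem_image_div_one_sub_iff, ← Complex.ofReal_inv, Complex.re_ofReal_mul, Complex.sub_re]
    have h2 : (2 * (q 0).re)⁻¹ * ((q z).re - (q 0).re) = (2 * (q 0).re)⁻¹ * (q z).re - 1 / 2 := by
      field_simp
    have h3 := hre z hz
    have : 0 < (2 * (q 0).re)⁻¹ * (q z).re := by positivity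
    linarith

/-! ### Univalence of close-to-convex functions -/

/-- On the diagonal, strict differentiability controls the difference quotient while both points
move. The compactness argument for univalence needs this joint continuity. -/
theorem continuousAt_dslope_uncurry {f : ℂ → ℂ} {U : Set ℂ} (hU : IsOpen U)
    (hf : DifferentiableOn ℂ f U) {p : ℂ × ℂ} (h1 : p.1 ∈ U) (h2 : p.2 ∈ U) :
    ContinuousAt (fun q : ℂ × ℂ => dslope f q.1 q.2) p := by
  obtain ⟨a, b⟩ := p
  simp only at h1 h2
  have hc : ∀ x ∈ U, ContinuousAt f x := fun x hx =>
    (hf.differentiableAt (hU.mem_nhds hx)).continuousAt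
  rcases eq_or_ne b a with rfl | hab
  · have han : AnalyticAt ℂ f b := hf.analyticAt (hU.mem_nhds h1)
    have hst := han.hasStrictDerivAt.isLittleO
    rw [ContinuousAt, Metric.tendsto_nhds]
    intro ε hε
    simp only [dslope_same]
    have hd : Tendsto (fun q : ℂ × ℂ => deriv f q.1) (𝓝 (b, b)) (𝓝 (deriv f b)) :=
      han.deriv.continuousAt.tendsto.comp continuousAt_fst
    filter_upwards [hst.def (half_pos hε), hd (ball_mem_nhds _ hε)] with q hq1 hq2
    rcases eq_or_ne q.2 q.1 with h | h
    · rw [h, dslope_same]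
      exact hq2
    · have hne : q.2 - q.1 ≠ 0 := sub_ne_zero.2 h
      rw [dslope_of_ne _ h, slope_def_field, dist_eq_norm]
      have e : (f q.2 - f q.1) / (q.2 - q.1) - deriv f b
          = (f q.1 - f q.2 - (q.1 - q.2) * deriv f b) / (q.1 - q.2) := by
        have : q.1 - q.2 ≠ 0 := sub_ne_zero.2 h.symm
        field_simp
        ring
      rw [e, norm_div]
      have hpos : 0 < ‖q.1 - q.2‖ := norm_pos_iff.2 (sub_ne_zero.2 h.symm)
      rw [div_lt_iff₀ hpos]
      have h3 : ‖f q.1 - f q.2 - (q.1 - q.2) * deriv f b‖ ≤ ε / 2 * ‖q.1 - q.2‖ := by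
        simpa using hq1
      nlinarith
  · have h3 : ContinuousAt (fun q : ℂ × ℂ => (f q.2 - f q.1) / (q.2 - q.1)) (a, b) := by
      refine ContinuousAt.div₀ (ContinuousAt.sub ?_ ?_) (by fun_prop) (sub_ne_zero.2 hab)
      · exact ContinuousAt.comp (g := f) (f := Prod.snd) (x := (a, b)) (hc b h2) continuousAt_snd
      · exact ContinuousAt.comp (g := f) (f := Prod.fst) (x := (a, b)) (hc a h1) continuousAt_fst
    refine h3.congr ?_
    have hne : ∀ᶠ q : ℂ × ℂ in 𝓝 (a, b), q.2 ≠ q.1 :=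
      (isOpen_ne_fun continuous_snd continuous_fst).mem_nhds hab
    filter_upwards [hne] with q hq
    rw [dslope_of_ne _ hq, slope_def_field]

/-- Along the Loewner chain `f + t g` the point with a prescribed image moves towards the
origin as `t` increases. -/
theorem exists_tendsto_norm_le_of_add_mul_eq {f g : ℂ → ℂ} {z : ℂ} {t : ℝ}
    (hf : AnalyticAt ℂ f z) (hg : AnalyticAt ℂ g z) (hz : z ≠ 0) (hgz : g z ≠ 0)
    (hre : 0 < (z * (deriv f z + t * deriv g z) / g z).re) :
    ∃ ζ : ℝ → ℂ, Tendsto ζ (𝓝[>] t) (𝓝 z) ∧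
      ∀ᶠ s in 𝓝[>] t, ‖ζ s‖ ≤ ‖z‖ ∧ f (ζ s) + s * g (ζ s) = f z + t * g z := by
  set c := f z + t * g z with hc
  have hfd := hf.hasStrictDerivAt
  have hgd := hg.hasStrictDerivAt
  set D := deriv f z + t * deriv g z with hD
  have hD0 : D ≠ 0 := by rintro h; simp [h] at hre
  -- Solving `f y + s g y = c` for `s` gives this function of `y`; its local inverse is the moving
  -- point.
  have hT : HasStrictDerivAt (fun y => (c - f y) / g y) (-D / g z) z := by
    refine ((hfd.const_sub c).fun_div hgd hgz).congr_deriv ?_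
    rw [div_eq_div_iff (pow_ne_zero 2 hgz) hgz, hc, hD]
    ring
  have hT0 : -D / g z ≠ 0 := div_ne_zero (neg_ne_zero.2 hD0) hgz
  have hTz : (c - f z) / g z = (t : ℂ) := by rw [hc]; field_simp; ring
  set L := hT.localInverse _ _ _ hT0 with hL
  have hLd : HasDerivAt L (-D / g z)⁻¹ (t : ℂ) := by
    have := (hT.to_localInverse hT0).hasDerivAt
    rwa [hTz] at this
  have hLt : L t = z := by
    rw [← hTz]
    exact (hT.eventually_left_inverse hT0).self_of_nhds
  have hLr : ∀ᶠ w in 𝓝 (t : ℂ), (c - f (L w)) / g (L w) = w := by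
    rw [← hTz]
    exact hT.eventually_right_inverse hT0
  have hofr : Tendsto (fun s : ℝ => (s : ℂ)) (𝓝 t) (𝓝 (t : ℂ)) := Complex.continuous_ofReal.tendsto t
  have hζd : HasDerivAt (fun s : ℝ => L s) (-D / g z)⁻¹ t := by
    exact (HasDerivAt.comp (h₂ := L) t hLd (Complex.ofRealCLM.hasDerivAt (x := t))).congr_deriv
      (by simp)
  have hζt : Tendsto (fun s : ℝ => L s) (𝓝 t) (𝓝 z) := by
    have := hζd.continuousAt.tendsto
    rwa [hLt] at this
  -- This is the derivative of `‖L s‖²` at `t`, equal to `-2 ‖z‖² Re (g/(z D))`.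
  have hneg : 2 * ((starRingEnd ℂ) (L t) * (-D / g z)⁻¹).re < 0 := by
    rw [hLt]
    have e : (starRingEnd ℂ) z * (-D / g z)⁻¹ = ((-(‖z‖ ^ 2) : ℝ) : ℂ) * (z * D / g z)⁻¹ := by
      have e4 : (starRingEnd ℂ) z = (‖z‖ ^ 2 : ℝ) / z := by
        rw [eq_div_iff hz, mul_comm, Complex.mul_conj, Complex.normSq_eq_norm_sq]
      rw [e4]
      push_cast
      field_simp
    rw [e, Complex.re_ofReal_mul, Complex.inv_re]
    have h1 : 0 < Complex.normSq (z * D / g z) :=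
      Complex.normSq_pos.2 (div_ne_zero (mul_ne_zero hz hD0) hgz)
    have h2 : 0 < ‖z‖ ^ 2 := by positivity
    have := mul_pos h2 (div_pos hre h1)
    linarith
  have hdec : ∀ᶠ s in 𝓝[>] t, ‖L (s : ℝ)‖ ^ 2 < ‖L t‖ ^ 2 := by
    have h1 := (hasDerivWithinAt_iff_tendsto_slope' self_notMem_Ioi).1
      (hζd.normSq_comp.hasDerivWithinAt (s := Ioi t))
    filter_upwards [h1.eventually (gt_mem_nhds hneg), self_mem_nhdsWithin] with s hs hst
    rw [slope_def_field, div_neg_iff] at hs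
    have : 0 < s - t := sub_pos.2 hst
    rcases hs with ⟨-, h⟩ | ⟨h, -⟩
    · linarith
    · linarith
  refine ⟨fun s => L s, tendsto_nhdsWithin_of_tendsto_nhds hζt, ?_⟩
  have hg0 : ∀ᶠ s : ℝ in 𝓝 t, g (L s) ≠ 0 := hζt.eventually (hg.continuousAt.eventually_ne hgz)
  filter_upwards [hdec, mem_nhdsWithin_of_mem_nhds hg0,
    mem_nhdsWithin_of_mem_nhds (hofr.eventually hLr)] with s hs1 hs2 hs3
  rw [hLt] at hs1
  refine ⟨(lt_of_pow_lt_pow_left₀ 2 (norm_nonneg _) hs1).le, ?_⟩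
  rw [div_eq_iff hs2] at hs3
  linear_combination -hs3

/-- Functions that are close-to-convex with respect to a convex function are univalent. -/
theorem IsConvexFunction.injOn_of_re_pos {f g : ℂ → ℂ} (hg : IsConvexFunction g)
    (hf : DifferentiableOn ℂ f (ball 0 1)) (hg0 : g 0 = 0) (hf0 : f 0 = 0)
    (hre0 : 0 < (deriv f 0 / deriv g 0).re)
    (hre : ∀ z ∈ ball (0 : ℂ) 1, z ≠ 0 → 0 < (z * deriv f z / g z).re) :
    InjOn f (ball 0 1) := by
  have h01 : (0 : ℂ) ∈ ball (0 : ℂ) 1 := mem_ball_self one_pos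
  have hgne : ∀ z ∈ ball (0 : ℂ) 1, z ≠ 0 → g z ≠ 0 := fun z hz hz0 h =>
    hz0 (hg.2.1 hz h01 (h.trans hg0.symm))
  have hret : ∀ t : ℝ, 0 ≤ t → ∀ z ∈ ball (0 : ℂ) 1, z ≠ 0 →
      0 < (z * (deriv f z + t * deriv g z) / g z).re := by
    intro t ht z hz hz0
    have h1 := hg.half_le_re hg0 hz hz0
    rw [show z * (deriv f z + t * deriv g z) / g z
      = z * deriv f z / g z + t * (z * deriv g z / g z) by ring, Complex.add_re,
      Complex.re_ofReal_mul]
    have := hre z hz hz0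
    nlinarith
  have hne : ∀ t : ℝ, 0 ≤ t → ∀ z ∈ ball (0 : ℂ) 1, deriv f z + t * deriv g z ≠ 0 := by
    intro t ht z hz h
    rcases eq_or_ne z 0 with rfl | hz0
    · have h1 : deriv f 0 / deriv g 0 = ((-t : ℝ) : ℂ) := by
        rw [div_eq_iff (hg.deriv_ne_zero h01)]
        push_cast
        linear_combination h
      rw [h1, Complex.ofReal_re] at hre0
      linarith
    · have := hret t ht z hz hz0
      simp [h] at this
  have hmove : ∀ t : ℝ, 0 ≤ t → ∀ z ∈ ball (0 : ℂ) 1, ∃ ζ : ℝ → ℂ,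
      Tendsto ζ (𝓝[>] t) (𝓝 z) ∧
      ∀ᶠ s in 𝓝[>] t, ‖ζ s‖ ≤ ‖z‖ ∧ f (ζ s) + s * g (ζ s) = f z + t * g z := by
    intro t ht z hz
    rcases eq_or_ne z 0 with rfl | hz0
    · exact ⟨fun _ => 0, tendsto_const_nhds, by simp [hf0, hg0]⟩
    · exact exists_tendsto_norm_le_of_add_mul_eq (hf.analyticAt (isOpen_ball.mem_nhds hz))
        (hg.1.analyticAt (isOpen_ball.mem_nhds hz)) hz0 (hgne z hz hz0) (hret t ht z hz hz0)
  intro z hz w hw hfzw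
  by_contra hzw
  set ρ := max ‖z‖ ‖w‖ with hρ
  have hρ1 : ρ < 1 := max_lt (by simpa using hz) (by simpa using hw)
  have hKD : closedBall (0 : ℂ) ρ ⊆ ball 0 1 := closedBall_subset_ball hρ1
  -- For `a ≠ b`, `f + t g` takes the same value at `a` and `b` exactly when `R (a, b) = -t`.
  -- Univalence of `g` keeps the denominator nonzero, including on the diagonal.
  set R : ℂ × ℂ → ℂ := fun q => dslope f q.1 q.2 / dslope g q.1 q.2 with hR
  have hgd : ∀ a ∈ ball (0 : ℂ) 1, ∀ b ∈ ball (0 : ℂ) 1, dslope g a b ≠ 0 := by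
    intro a ha b hb
    rcases eq_or_ne b a with rfl | hab
    · rw [dslope_same]; exact hg.deriv_ne_zero hb
    · rw [dslope_of_ne _ hab, slope_def_field]
      exact div_ne_zero (sub_ne_zero.2 fun h => hab (hg.2.1 hb ha h)) (sub_ne_zero.2 hab)
  have hRc : ContinuousOn R (closedBall 0 ρ ×ˢ closedBall 0 ρ) := fun q hq =>
    ((continuousAt_dslope_uncurry isOpen_ball hf (hKD hq.1) (hKD hq.2)).div₀
      (continuousAt_dslope_uncurry isOpen_ball hg.1 (hKD hq.1) (hKD hq.2))
      (hgd _ (hKD hq.1) _ (hKD hq.2))).continuousWithinAt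
  have hReq : ∀ a ∈ ball (0 : ℂ) 1, ∀ b ∈ ball (0 : ℂ) 1, b ≠ a → ∀ s : ℝ,
      (R (a, b) = ((-s : ℝ) : ℂ) ↔ f b + s * g b = f a + s * g a) := by
    intro a ha b hb hab s
    have h1 : b - a ≠ 0 := sub_ne_zero.2 hab
    have h2 : g b - g a ≠ 0 := sub_ne_zero.2 fun h => hab (hg.2.1 hb ha h)
    simp only [hR]
    rw [dslope_of_ne _ hab, dslope_of_ne _ hab, slope_def_field, slope_def_field,
      div_div_div_cancel_right₀ h1, div_eq_iff h2]
    push_cast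
    constructor <;> intro h <;> linear_combination h
  set S : Set ℂ := {x | x.im = 0 ∧ x.re ≤ 0} with hS
  have hSc : IsClosed S :=
    (isClosed_eq Complex.continuous_im continuous_const).inter
      (isClosed_le Complex.continuous_re continuous_const)
  have hKK : IsCompact (closedBall (0 : ℂ) ρ ×ˢ closedBall (0 : ℂ) ρ) :=
    (isCompact_closedBall 0 ρ).prod (isCompact_closedBall 0 ρ)
  have hTc : IsCompact ((closedBall 0 ρ ×ˢ closedBall 0 ρ) ∩ R ⁻¹' S) :=
    hKK.of_isClosed_subset (hRc.preimage_isClosed_of_isClosed hKK.isClosed hSc) inter_subset_left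
  have hTn : ((closedBall 0 ρ ×ˢ closedBall 0 ρ) ∩ R ⁻¹' S).Nonempty := by
    refine ⟨(w, z), ⟨by simp [hρ], by simp [hρ]⟩, ?_⟩
    have := (hReq w hw z hz hzw 0).2 (by simp [hfzw])
    rw [mem_preimage, this]
    simp [hS]
  -- A coincidence in the compact bidisc with the largest possible `t`. It is off the diagonal
  -- because `f' + t g'` has no zero; moving both points along the chain yields a coincidence in the
  -- same bidisc with a larger parameter.
  obtain ⟨⟨a, b⟩, ⟨⟨ha, hb⟩, hab⟩, hmin⟩ := hTc.exists_isMinOn hTn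
    (Complex.continuous_re.comp_continuousOn (hRc.mono inter_subset_left))
  simp only at ha hb
  set t := -(R (a, b)).re with ht
  have ht0 : 0 ≤ t := neg_nonneg.2 hab.2
  have hRt : R (a, b) = ((-t : ℝ) : ℂ) := by
    apply Complex.ext
    · simp [ht]
    · simpa using hab.1
  have hne_ab : b ≠ a := by
    rintro rfl
    simp only [hR, dslope_same] at hRt
    rw [div_eq_iff (hg.deriv_ne_zero (hKD hb))] at hRt
    refine hne t ht0 b (hKD hb) ?_
    push_cast at hRt
    linear_combination hRt
  have heq := (hReq a (hKD ha) b (hKD hb) hne_ab t).1 hRt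
  obtain ⟨α, hα, hα'⟩ := hmove t ht0 a (hKD ha)
  obtain ⟨β, hβ, hβ'⟩ := hmove t ht0 b (hKD hb)
  have hne' : ∀ᶠ s in 𝓝[>] t, β s ≠ α s :=
    (hβ.prodMk_nhds hα).eventually
      ((isOpen_ne_fun continuous_fst continuous_snd).mem_nhds (x := (b, a)) hne_ab)
  obtain ⟨s, ⟨⟨h1, h2⟩, h3, h4⟩, h5, hst⟩ :=
    ((hα'.and hβ').and (hne'.and self_mem_nhdsWithin)).exists
  have hst' : t < s := hst
  have hαK : α s ∈ closedBall (0 : ℂ) ρ := by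
    rw [mem_closedBall_zero_iff] at ha ⊢; exact h1.trans ha
  have hβK : β s ∈ closedBall (0 : ℂ) ρ := by
    rw [mem_closedBall_zero_iff] at hb ⊢; exact h3.trans hb
  have hRs := (hReq _ (hKD hαK) _ (hKD hβK) h5 s).2 (by rw [h2, h4, heq])
  have hmem : (α s, β s) ∈ (closedBall 0 ρ ×ˢ closedBall 0 ρ) ∩ R ⁻¹' S := by
    refine ⟨⟨hαK, hβK⟩, ?_⟩
    rw [mem_preimage, hRs]
    simp only [hS, mem_ofPred_eq, Complex.ofReal_im, Complex.ofReal_re, true_and]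
    linarith
  have h6 : (R (a, b)).re ≤ (R (α s, β s)).re := hmin hmem
  rw [hRs, Complex.ofReal_re] at h6
  linarith

/-! ### The covering theorem and the distance to the boundary -/

/-- A primitive of the lower bound for `|f'|`; it vanishes at 0 and equals `1 - log 2` at 1. -/
theorem hasDerivAt_two_mul_div_one_add_sub_log {r : ℝ} (hr : -1 < r) :
    HasDerivAt (fun x : ℝ => 2 * x / (1 + x) - Real.log (1 + x)) ((1 - r) / (1 + r) ^ 2) r := by
  have h0 : 1 + r ≠ 0 := by linarith
  have h1 : HasDerivAt (fun x : ℝ => 1 + x) 1 r := (hasDerivAt_id r).const_add 1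
  have h2 : HasDerivAt (fun x : ℝ => 2 * x) 2 r := by simpa using (hasDerivAt_id r).const_mul 2
  refine ((h2.fun_div h1 h0).fun_sub (h1.log h0)).congr_deriv ?_
  field_simp
  ring

theorem strictMonoOn_two_mul_div_one_add_sub_log :
    StrictMonoOn (fun x : ℝ => 2 * x / (1 + x) - Real.log (1 + x)) (Icc 0 1) := by
  refine strictMonoOn_of_deriv_pos (convex_Icc 0 1) (fun x hx => ?_) (fun x hx => ?_)
  · exact (hasDerivAt_two_mul_div_one_add_sub_log (by linarith [hx.1])).continuousAt.continuousWithinAt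
  · rw [interior_Icc] at hx
    rw [(hasDerivAt_two_mul_div_one_add_sub_log (by linarith [hx.1])).deriv]
    have : 0 < 1 - x := by linarith [hx.2]
    have : 0 < 1 + x := by linarith [hx.1]
    positivity

/-- A covering theorem: a lower bound for `|f'|` gives a disc inside the image. -/
theorem Set.InjOn.ball_subset_image_of_norm_deriv_ge {f : ℂ → ℂ}
    (hf : DifferentiableOn ℂ f (ball 0 1)) (hinj : InjOn f (ball 0 1)) (hf0 : f 0 = 0)
    (hd : ∀ z ∈ ball (0 : ℂ) 1, 1 - ‖z‖ ≤ ‖deriv f z‖ * (1 + ‖z‖) ^ 2) :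
    ball 0 (1 - Real.log 2) ⊆ f '' ball 0 1 := by
  have h01 : (0 : ℂ) ∈ ball (0 : ℂ) 1 := mem_ball_self one_pos
  obtain ⟨hop, hne, h, hh, hleft⟩ := hinj.exists_holomorphic_inverse isOpen_ball
    (convex_ball 0 1).isPreconnected hf
  intro w₀ hw₀
  by_contra hw₀'
  set K : ℝ → ℝ := fun x => 2 * x / (1 + x) - Real.log (1 + x) with hK
  have hKm := strictMonoOn_two_mul_div_one_add_sub_log
  rw [← hK] at hKm
  have hKc : ContinuousOn K (Icc 0 1) := fun x hx =>
    (hasDerivAt_two_mul_div_one_add_sub_log (by linarith [hx.1])).continuousAt.continuousWithinAt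
  have hK0 : K 0 = 0 := by simp [hK]
  have hK1 : K 1 = 1 - Real.log 2 := by simp only [hK]; norm_num
  -- A nearest omitted value: minimality puts the half-open segment `[0, w)` in the image, so it
  -- lifts to a curve `G` in the disc.
  obtain ⟨w, hw, hwd⟩ := hop.isClosed_compl.exists_infDist_eq_dist ⟨w₀, hw₀'⟩ 0
  have hwd' : ‖w‖ < 1 - Real.log 2 := by
    have h1 : infDist 0 (f '' ball 0 1)ᶜ ≤ dist 0 w₀ := infDist_le_dist_of_mem hw₀'
    rw [hwd, dist_zero_left, dist_zero_left] at h1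
    exact h1.trans_lt (by simpa using hw₀)
  have hw0 : 0 < ‖w‖ := by
    refine norm_pos_iff.2 ?_
    rintro rfl
    exact hw ⟨0, h01, hf0⟩
  have hmem : ∀ t ∈ Ico (0 : ℝ) 1, (t : ℂ) * w ∈ f '' ball 0 1 := by
    intro t ht
    by_contra hc
    have h1 : infDist 0 (f '' ball 0 1)ᶜ ≤ dist 0 ((t : ℂ) * w) := infDist_le_dist_of_mem hc
    rw [hwd, dist_zero_left, dist_zero_left, norm_mul, Complex.norm_real,
      Real.norm_of_nonneg ht.1] at h1
    nlinarith [ht.2]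
  set G : ℝ → ℂ := fun t => h (t * w) with hG
  have hGD : ∀ t ∈ Ico (0 : ℝ) 1, G t ∈ ball (0 : ℂ) 1 ∧ f (G t) = t * w := by
    intro t ht
    obtain ⟨y, hy, hyt⟩ := hmem t ht
    simp only [hG]
    rw [← hyt, hleft y hy]
    exact ⟨hy, rfl⟩
  have hGd : ∀ t ∈ Ico (0 : ℝ) 1, HasDerivAt G ((deriv f (G t))⁻¹ * w) t := by
    intro t ht
    obtain ⟨h1, h2⟩ := hGD t ht
    have h3 : HasDerivAt h (deriv h (f (G t))) (f (G t)) :=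
      (hh.differentiableAt (hop.mem_nhds (mem_image_of_mem f h1))).hasDerivAt
    have h4 : HasDerivAt f (deriv f (G t)) (G t) :=
      (hf.differentiableAt (isOpen_ball.mem_nhds h1)).hasDerivAt
    have h5 : HasDerivAt (h ∘ f) 1 (G t) := (hasDerivAt_id _).congr_of_eventuallyEq
      (by filter_upwards [isOpen_ball.mem_nhds h1] with y hy using hleft y hy)
    rw [eq_inv_of_mul_eq_one_left ((h3.comp _ h4).unique h5), h2] at h3
    have h6 : HasDerivAt (fun s : ℝ => (s : ℂ) * w) w t := by
      simpa using (Complex.ofRealCLM.hasDerivAt (x := t)).mul_const w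
    exact HasDerivAt.comp (h₂ := h) t h3 h6
  have hG0 : G 0 = 0 := by
    simp only [hG, Complex.ofReal_zero, zero_mul]
    rw [← hf0, hleft 0 h01, hf0]
  have hGne : ∀ t ∈ Ioo (0 : ℝ) 1, 0 < ‖G t‖ := by
    intro t ht
    refine norm_pos_iff.2 fun h1 => ?_
    have h2 := (hGD t ⟨ht.1.le, ht.2⟩).2
    rw [h1, hf0] at h2
    rcases mul_eq_zero.1 h2.symm with h3 | h3
    · exact ht.1.ne' (by simpa using h3)
    · simp [h3] at hw0
  have hder : ∀ t ∈ Ioo (0 : ℝ) 1, ∃ d ≤ 0,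
      HasDerivAt (fun s => K ‖G s‖ - s * ‖w‖) d t := by
    intro t ht
    obtain ⟨h1, h2⟩ := hGD t ⟨ht.1.le, ht.2⟩
    have hpos := hGne t ht
    have hlt : ‖G t‖ < 1 := by simpa using h1
    have h3 := (hGd t ⟨ht.1.le, ht.2⟩).normSq_comp.sqrt (by positivity)
    simp only [Real.sqrt_sq (norm_nonneg _)] at h3
    have h4 : HasDerivAt K ((1 - ‖G t‖) / (1 + ‖G t‖) ^ 2) ‖G t‖ :=
      hasDerivAt_two_mul_div_one_add_sub_log (by linarith)
    have h5 := (HasDerivAt.comp t h4 h3).fun_sub ((hasDerivAt_id t).mul_const ‖w‖)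
    refine ⟨_, ?_, h5⟩
    have h6 : ((starRingEnd ℂ) (G t) * ((deriv f (G t))⁻¹ * w)).re
        ≤ ‖G t‖ * (‖deriv f (G t)‖⁻¹ * ‖w‖) := by
      refine (Complex.re_le_norm _).trans (le_of_eq ?_)
      simp
    have h7 := hd _ h1
    have h8 : 0 < ‖deriv f (G t)‖ := norm_pos_iff.2 (hne _ h1)
    rw [mul_div_mul_left _ _ two_ne_zero, one_mul, sub_nonpos]
    calc (1 - ‖G t‖) / (1 + ‖G t‖) ^ 2 *
          (((starRingEnd ℂ) (G t) * ((deriv f (G t))⁻¹ * w)).re / ‖G t‖)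
        ≤ ‖deriv f (G t)‖ * (‖G t‖ * (‖deriv f (G t)‖⁻¹ * ‖w‖) / ‖G t‖) := by
          have : 0 ≤ (1 - ‖G t‖) / (1 + ‖G t‖) ^ 2 :=
            div_nonneg (by linarith) (by positivity)
          refine (mul_le_mul_of_nonneg_left (div_le_div_of_nonneg_right h6 hpos.le) this).trans ?_
          refine mul_le_mul_of_nonneg_right ?_ (by positivity)
          rwa [div_le_iff₀ (by positivity)]
      _ = ‖w‖ := by field_simp
  have hanti : AntitoneOn (fun s => K ‖G s‖ - s * ‖w‖) (Ico 0 1) := by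
    refine antitoneOn_of_deriv_nonpos (convex_Ico 0 1) ?_ ?_ ?_
    · intro t ht
      have h1 : ContinuousAt (fun s => ‖G s‖) t := (hGd t ht).continuousAt.norm
      have h2 : ContinuousAt K ‖G t‖ :=
        (hasDerivAt_two_mul_div_one_add_sub_log (by linarith [norm_nonneg (G t)])).continuousAt
      exact ((ContinuousAt.comp (g := K) (f := fun s => ‖G s‖) h2 h1).sub
        (continuousAt_id.mul continuousAt_const)).continuousWithinAt
    · intro t ht
      rw [interior_Ico] at ht
      obtain ⟨d, -, h⟩ := hder t ht
      exact h.differentiableAt.differentiableWithinAt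
    · intro t ht
      rw [interior_Ico] at ht
      obtain ⟨d, hd0, h⟩ := hder t ht
      rwa [h.deriv]
  have hKG : ∀ t ∈ Ico (0 : ℝ) 1, K ‖G t‖ ≤ ‖w‖ := by
    intro t ht
    have h1 := hanti (left_mem_Ico.2 one_pos) ht ht.1
    simp only [hG0, norm_zero, hK0, zero_mul, sub_zero] at h1
    nlinarith [ht.2]
  -- Since `K ‖G t‖ ≤ ‖w‖ = K r₀`, the lift stays in the compact disc of radius `r₀ < 1`. The image
  -- of that disc is closed, so it contains `w`, a contradiction.
  obtain ⟨r₀, hr₀, hKr₀⟩ := intermediate_value_Ico zero_le_one hKc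
    (show ‖w‖ ∈ Ico (K 0) (K 1) by rw [hK0, hK1]; exact ⟨hw0.le, hwd'⟩)
  have hsub : closedBall (0 : ℂ) r₀ ⊆ ball 0 1 := closedBall_subset_ball hr₀.2
  have hcomp : IsCompact (f '' closedBall 0 r₀) :=
    (isCompact_closedBall 0 r₀).image_of_continuousOn (hf.continuousOn.mono hsub)
  refine hw (image_mono hsub ?_)
  have ht : Tendsto (fun t : ℝ => (t : ℂ) * w) (𝓝[<] 1) (𝓝 w) := by
    have : Continuous fun t : ℝ => (t : ℂ) * w := by fun_prop
    simpa using tendsto_nhdsWithin_of_tendsto_nhds (s := Iio 1) (this.tendsto 1)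
  refine hcomp.isClosed.mem_of_tendsto ht ?_
  filter_upwards [Ioo_mem_nhdsLT (zero_lt_one' ℝ)] with t ht
  have ht' : t ∈ Ico (0 : ℝ) 1 := ⟨ht.1.le, ht.2⟩
  obtain ⟨h1, h2⟩ := hGD t ht'
  refine ⟨G t, ?_, h2⟩
  rw [mem_closedBall_zero_iff]
  by_contra! hlt
  have h3 := hKm ⟨hr₀.1, hr₀.2.le⟩
    ⟨norm_nonneg _, le_of_lt (by simpa using h1)⟩ hlt
  linarith [hKG t ht']

/-- A univalent function on the disc is not surjective. -/
theorem Set.InjOn.image_ball_ne_univ {f : ℂ → ℂ} (hf : DifferentiableOn ℂ f (ball 0 1))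
    (hinj : InjOn f (ball 0 1)) : f '' ball 0 1 ≠ univ := by
  intro hu
  obtain ⟨-, -, h, hh, hleft⟩ := hinj.exists_holomorphic_inverse isOpen_ball
    (convex_ball 0 1).isPreconnected hf
  rw [hu, differentiableOn_univ] at hh
  have hb : Bornology.IsBounded (range h) := by
    refine isBounded_ball.subset (t := ball (0 : ℂ) 1) ?_
    rintro _ ⟨w, rfl⟩
    obtain ⟨y, hy, rfl⟩ : w ∈ f '' ball 0 1 := hu ▸ mem_univ w
    rwa [hleft y hy]
  have h0 : (0 : ℂ) ∈ ball (0 : ℂ) 1 := mem_ball_self one_pos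
  have h1 : (1 / 2 : ℂ) ∈ ball (0 : ℂ) 1 := by
    rw [mem_ball_zero_iff]; norm_num
  have := hh.apply_eq_apply_of_bounded hb (f 0) (f (1 / 2))
  rw [hleft _ h0, hleft _ h1] at this
  norm_num at this

/-- An open image misses its frontier. Nonemptiness of the frontier must be checked because
`infDist` to the empty set is 0. -/
theorem le_boundaryDist_of_ball_subset {f : ℂ → ℂ} (hf : DifferentiableOn ℂ f (ball 0 1))
    (hinj : InjOn f (ball 0 1)) (hf0 : f 0 = 0) {d : ℝ} (hd : ball 0 d ⊆ f '' ball 0 1) :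
    d ≤ boundaryDist f := by
  have hop := (hinj.exists_holomorphic_inverse isOpen_ball
    (convex_ball 0 1).isPreconnected hf).1
  have hne : (frontier (f '' ball 0 1)).Nonempty :=
    nonempty_frontier_iff.2 ⟨(nonempty_ball.2 one_pos).image f, hinj.image_ball_ne_univ hf⟩
  rw [boundaryDist, le_infDist hne]
  intro y hy
  by_contra! hlt
  rw [hop.frontier_eq] at hy
  exact hy.2 (hd (by rwa [mem_ball, dist_comm, ← hf0]))

/-! ### Taylor coefficients, the factorisation of `f'` and its consequences -/

theorem taylorCoeff_mul {p u : ℂ → ℂ} (hp : AnalyticAt ℂ p 0) (hu : AnalyticAt ℂ u 0) (n : ℕ) :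
    taylorCoeff (p * u) n
      = ∑ i ∈ Finset.range (n + 1), taylorCoeff p i * taylorCoeff u (n - i) := by
  rw [taylorCoeff, iteratedDeriv_mul hp.contDiffAt hu.contDiffAt, Finset.sum_div]
  refine Finset.sum_congr rfl fun i hi => ?_
  have hin : i ≤ n := Nat.lt_succ_iff.1 (Finset.mem_range.1 hi)
  rw [Nat.cast_choose ℂ hin, taylorCoeff, taylorCoeff]
  have h1 : (n.factorial : ℂ) ≠ 0 := by exact_mod_cast n.factorial_ne_zero
  have h2 : (i.factorial : ℂ) ≠ 0 := by exact_mod_cast i.factorial_ne_zero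
  have h3 : ((n - i).factorial : ℂ) ≠ 0 := by exact_mod_cast (n - i).factorial_ne_zero
  field_simp

theorem taylorCoeff_deriv (f : ℂ → ℂ) (n : ℕ) :
    taylorCoeff (deriv f) n = (n + 1) * taylorCoeff f (n + 1) := by
  rw [taylorCoeff, taylorCoeff, iteratedDeriv_succ', Nat.factorial_succ]
  have h1 : (n.factorial : ℂ) ≠ 0 := by exact_mod_cast n.factorial_ne_zero
  have h2 : (n : ℂ) + 1 ≠ 0 := by exact_mod_cast n.succ_ne_zero
  push_cast
  field_simp

theorem taylorCoeff_id (n : ℕ) : taylorCoeff id n = if n = 1 then 1 else 0 := by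
  rw [taylorCoeff, iteratedDeriv_id]
  rcases n with _ | _ | n <;> simp

theorem taylorCoeff_dslope {g : ℂ → ℂ} (hg : DifferentiableOn ℂ g (ball 0 1)) (h0 : g 0 = 0)
    (n : ℕ) : taylorCoeff (dslope g 0) n = taylorCoeff g (n + 1) := by
  have hb : ball (0 : ℂ) 1 ∈ 𝓝 0 := ball_mem_nhds 0 one_pos
  have hu : AnalyticAt ℂ (dslope g 0) 0 :=
    ((Complex.differentiableOn_dslope hb).2 hg).analyticAt hb
  have h1 : g = id * dslope g 0 := by
    ext y
    have := sub_smul_dslope g 0 y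
    simpa [h0] using this.symm
  conv_rhs => rw [h1, taylorCoeff_mul analyticAt_id hu]
  rw [Finset.sum_eq_single 1]
  · simp [taylorCoeff_id]
  · intro i _ hi
    simp [taylorCoeff_id, hi]
  · intro h
    exact absurd (Finset.mem_range.2 (by omega)) h

theorem hasSum_taylorCoeff {f : ℂ → ℂ} (hf : DifferentiableOn ℂ f (ball 0 1)) (hf0 : f 0 = 0)
    {z : ℂ} (hz : z ∈ ball (0 : ℂ) 1) :
    HasSum (fun n => taylorCoeff f (n + 1) * z ^ (n + 1)) (f z) := by
  have h1 : HasSum (fun n => taylorCoeff f n * z ^ n) (f z) := by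
    have := Complex.hasSum_taylorSeries_on_ball hf hz
    refine this.congr_fun ?_
    intro n
    simp only [taylorCoeff, sub_zero, smul_eq_mul]
    ring
  rw [← hasSum_nat_add_iff' 1] at h1
  simpa [taylorCoeff, hf0] using h1

/-- The factorisation `f' = p · g(z)/z` of the derivative of a function of the class. -/
theorem NormalizedC1.exists_factorization {f : ℂ → ℂ} (hf : f ∈ NormalizedC1) :
    ∃ g p : ℂ → ℂ, IsConvexFunction g ∧ g 0 = 0 ∧ DifferentiableOn ℂ p (ball 0 1) ∧
      (∀ z ∈ ball (0 : ℂ) 1, 0 < (p z).re) ∧ p 0 = (deriv g 0)⁻¹ ∧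
      ∀ z ∈ ball (0 : ℂ) 1, deriv f z = p z * dslope g 0 z := by
  obtain ⟨⟨hfd, g, hg, hg0, hgre, hre⟩, hf0, hf1⟩ := hf
  have h01 : (0 : ℂ) ∈ ball (0 : ℂ) 1 := mem_ball_self one_pos
  have hund : DifferentiableOn ℂ (dslope g 0) (ball 0 1) :=
    (Complex.differentiableOn_dslope (isOpen_ball.mem_nhds h01)).2 hg.1
  refine ⟨g, fun z => deriv f z / dslope g 0 z, hg, hg0,
    (hfd.deriv isOpen_ball).fun_div hund fun z hz => IsConvexFunction.dslope_ne_zero hg hz, ?_, ?_, ?_⟩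
  · intro z hz
    rcases eq_or_ne z 0 with rfl | hz0
    · simp only
      rw [dslope_same, hf1, one_div, Complex.inv_re]
      exact div_pos hgre (Complex.normSq_pos.2 (hg.deriv_ne_zero h01))
    · have h1 := hre z hz hz0
      have h2 : g z = z * dslope g 0 z := by
        have := sub_smul_dslope g 0 z
        simpa [hg0] using this.symm
      rwa [h2, mul_div_mul_left _ _ hz0] at h1
  · simp [hf1]
  · intro z hz
    exact (div_mul_cancel₀ _ (IsConvexFunction.dslope_ne_zero hg hz)).symm

theorem NormalizedC1.injOn {f : ℂ → ℂ} (hf : f ∈ NormalizedC1) : InjOn f (ball 0 1) := by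
  obtain ⟨⟨hfd, g, hg, hg0, hgre, hre⟩, hf0, hf1⟩ := hf
  refine hg.injOn_of_re_pos hfd hg0 hf0 ?_ hre
  rw [hf1, one_div, Complex.inv_re]
  exact div_pos hgre (Complex.normSq_pos.2 (hg.deriv_ne_zero (mem_ball_self one_pos)))

theorem NormalizedC1.one_sub_log_two_le_boundaryDist {f : ℂ → ℂ} (hf : f ∈ NormalizedC1) :
    1 - Real.log 2 ≤ boundaryDist f := by
  have hinj := NormalizedC1.injOn hf
  obtain ⟨g, p, hg, hg0, hpd, hpre, hp0, hfp⟩ :=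
    NormalizedC1.exists_factorization hf
  have h01 : (0 : ℂ) ∈ ball (0 : ℂ) 1 := mem_ball_self one_pos
  refine le_boundaryDist_of_ball_subset hf.1.1 hinj hf.2.1
    (hinj.ball_subset_image_of_norm_deriv_ge hf.1.1 hf.2.1 fun z hz => ?_)
  have h1 := Complex.norm_mul_one_sub_le_of_re_nonneg hpd (fun y hy => (hpre y hy).le)
    (hpre 0 h01) hz
  have h2 := hg.norm_deriv_le_norm_dslope hg0 hz
  have hb : 0 < ‖deriv g 0‖ := norm_pos_iff.2 (hg.deriv_ne_zero h01)
  have hz1 : ‖z‖ < 1 := by simpa using hz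
  rw [hp0, norm_inv] at h1
  rw [hfp z hz, norm_mul]
  calc 1 - ‖z‖ = ‖deriv g 0‖⁻¹ * (1 - ‖z‖) * ‖deriv g 0‖ := by field_simp
    _ ≤ ‖p z‖ * (1 + ‖z‖) * (‖dslope g 0 z‖ * (1 + ‖z‖)) := by gcongr
    _ = ‖p z‖ * ‖dslope g 0 z‖ * (1 + ‖z‖) ^ 2 := by ring

/-- The sharp coefficient bound in the class. -/
theorem NormalizedC1.norm_taylorCoeff_le {f : ℂ → ℂ} (hf : f ∈ NormalizedC1) (n : ℕ) :
    ‖taylorCoeff f (n + 1)‖ ≤ 2 - 1 / ((n + 1 : ℕ) : ℝ) := by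
  obtain ⟨g, p, hg, hg0, hpd, hpre, hp0, hfp⟩ :=
    NormalizedC1.exists_factorization hf
  have h01 : (0 : ℂ) ∈ ball (0 : ℂ) 1 := mem_ball_self one_pos
  have hnhds : ball (0 : ℂ) 1 ∈ 𝓝 0 := isOpen_ball.mem_nhds h01
  have hb : 0 < ‖deriv g 0‖ := norm_pos_iff.2 (hg.deriv_ne_zero h01)
  have hu : AnalyticAt ℂ (dslope g 0) 0 :=
    ((Complex.differentiableOn_dslope hnhds).2 hg.1).analyticAt hnhds
  have hcong : deriv f =ᶠ[𝓝 0] p * dslope g 0 := by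
    filter_upwards [hnhds] with z hz using hfp z hz
  have h1 : ((n : ℂ) + 1) * taylorCoeff f (n + 1)
      = ∑ i ∈ Finset.range (n + 1), taylorCoeff p i * taylorCoeff g (n - i + 1) := by
    rw [← taylorCoeff_deriv, taylorCoeff, hcong.iteratedDeriv_eq, ← taylorCoeff,
      taylorCoeff_mul (hpd.analyticAt hnhds) hu]
    exact Finset.sum_congr rfl fun i _ => by rw [taylorCoeff_dslope hg.1 hg0]
  have hgc : ∀ k, ‖taylorCoeff g (k + 1)‖ ≤ ‖deriv g 0‖ := fun k =>
    hg.norm_taylorCoeff_le hg.1 (mapsTo_image g _) rfl (by omega)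
  have hp0n : ‖taylorCoeff p 0‖ = ‖deriv g 0‖⁻¹ := by simp [taylorCoeff, hp0]
  have hpc : ∀ k, ‖taylorCoeff p (k + 1)‖ ≤ 2 * ‖deriv g 0‖⁻¹ := by
    intro k
    refine (norm_taylorCoeff_le_of_re_pos hpd hpre (by omega)).trans ?_
    have := Complex.re_le_norm (p 0)
    rw [hp0, norm_inv] at this
    rw [hp0]
    linarith
  -- The `n` terms with a positive-degree coefficient of `p` contribute at most 2 each, and the term
  -- with `p 0` at most 1.
  have h2 : ‖((n : ℂ) + 1) * taylorCoeff f (n + 1)‖ ≤ 2 * n + 1 := by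
    rw [h1, Finset.sum_range_succ']
    refine (norm_add_le _ _).trans (add_le_add ((norm_sum_le _ _).trans ?_) ?_)
    · have h3 : ∀ i ∈ Finset.range n,
          ‖taylorCoeff p (i + 1) * taylorCoeff g (n - (i + 1) + 1)‖ ≤ 2 := by
        intro i _
        rw [norm_mul]
        calc _ ≤ 2 * ‖deriv g 0‖⁻¹ * ‖deriv g 0‖ := by
              gcongr
              · exact hpc i
              · exact hgc _
          _ = 2 := by field_simp
      refine (Finset.sum_le_card_nsmul _ _ _ h3).trans (le_of_eq ?_)
      simp [mul_comm]
    · rw [norm_mul, hp0n, inv_mul_le_iff₀ hb, mul_one]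
      exact hgc _
  have hn : (0 : ℝ) < n + 1 := by positivity
  have h3 : ‖(n : ℂ) + 1‖ = (n : ℝ) + 1 := by
    have : ((n : ℂ) + 1) = (((n : ℝ) + 1 : ℝ) : ℂ) := by push_cast; rfl
    rw [this, Complex.norm_real, Real.norm_of_nonneg hn.le]
  rw [norm_mul, h3] at h2
  push_cast
  rw [show (2 : ℝ) - 1 / ((n : ℝ) + 1) = (2 * n + 1) / (n + 1) by field_simp; ring,
    le_div_iff₀ hn]
  linarith

/-! ### The radius equation -/

/-- The geometric series minus the logarithmic one. The closed form in `radiusFun` is thus the full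
majorant series, and the sum over `n ≥ N` is its tail. -/
theorem hasSum_two_sub_inv_mul_pow {r : ℝ} (h0 : 0 ≤ r) (h1 : r < 1) :
    HasSum (fun n : ℕ => (2 - 1 / ((n + 1 : ℕ) : ℝ)) * r ^ (n + 1))
      (2 * r / (1 - r) + Real.log (1 - r)) := by
  have ha : |r| < 1 := by rwa [abs_of_nonneg h0]
  have h2 := ((hasSum_geometric_of_lt_one h0 h1).mul_left (2 * r)).sub
    (Real.hasSum_pow_div_log_of_abs_lt_one ha)
  rw [sub_neg_eq_add, ← div_eq_mul_inv] at h2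
  refine h2.congr_fun fun n => ?_
  push_cast
  ring

theorem one_le_two_sub_inv (n : ℕ) : (1 : ℝ) ≤ 2 - 1 / ((n + 1 : ℕ) : ℝ) := by
  have : (1 : ℝ) / ((n + 1 : ℕ) : ℝ) ≤ 1 := by
    rw [div_le_one (by positivity)]
    push_cast
    linarith [(Nat.cast_nonneg n : (0 : ℝ) ≤ n)]
  linarith

theorem summable_radiusFun_tail (M : ℕ) {r : ℝ} (h0 : 0 ≤ r) (h1 : r < 1) :
    Summable fun k : ℕ => (2 - 1 / ((M + 1 + k : ℕ) : ℝ)) * r ^ (M + 1 + k) := by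
  refine ((summable_nat_add_iff M).2 (hasSum_two_sub_inv_mul_pow h0 h1).summable).congr
    fun k => ?_
  rw [show k + M + 1 = M + 1 + k by omega]

theorem radiusFun_tail_eq (M : ℕ) {r : ℝ} (h0 : 0 ≤ r) (h1 : r < 1) :
    ∑' k : ℕ, (2 - 1 / ((M + 1 + k : ℕ) : ℝ)) * r ^ (M + 1 + k)
      = 2 * r / (1 - r) + Real.log (1 - r)
        - ∑ n ∈ Finset.range M, (2 - 1 / ((n + 1 : ℕ) : ℝ)) * r ^ (n + 1) := by
  have h2 := hasSum_two_sub_inv_mul_pow h0 h1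
  have h3 := h2.summable.sum_add_tsum_nat_add M
  rw [h2.tsum_eq] at h3
  rw [eq_sub_iff_add_eq, add_comm, ← h3]
  congr 1
  exact tsum_congr fun k => by rw [show k + M + 1 = M + 1 + k by omega]

theorem strictMonoOn_radiusFun (M : ℕ) : StrictMonoOn (radiusFun (M + 1)) (Ico 0 1) := by
  intro r hr s hs hrs
  have h1 : 2 * r / (1 - r) + Real.log (1 - r) < 2 * s / (1 - s) + Real.log (1 - s) := by
    refine hasSum_lt (i := 0) (fun n => ?_) ?_ (hasSum_two_sub_inv_mul_pow hr.1 hr.2)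
      (hasSum_two_sub_inv_mul_pow hs.1 hs.2)
    · have := one_le_two_sub_inv n
      exact mul_le_mul_of_nonneg_left (pow_le_pow_left₀ hr.1 hrs.le _) (by linarith)
    · norm_num
      exact hrs
  have h2 : ∑' k : ℕ, (2 - 1 / ((M + 1 + k : ℕ) : ℝ)) * r ^ (M + 1 + k)
      ≤ ∑' k : ℕ, (2 - 1 / ((M + 1 + k : ℕ) : ℝ)) * s ^ (M + 1 + k) := by
    refine (summable_radiusFun_tail M hr.1 hr.2).tsum_le_tsum (fun k => ?_)
      (summable_radiusFun_tail M hs.1 hs.2)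
    have := one_le_two_sub_inv (M + k)
    rw [show M + k + 1 = M + 1 + k by omega] at this
    exact mul_le_mul_of_nonneg_left (pow_le_pow_left₀ hr.1 hrs.le _) (by linarith)
  rw [radiusFun, radiusFun]
  linarith

theorem continuousOn_radiusFun (M : ℕ) : ContinuousOn (radiusFun (M + 1)) (Ico 0 1) := by
  have h : ContinuousOn (fun r : ℝ => 2 * r / (1 - r) + Real.log (1 - r)
      + (2 * r / (1 - r) + Real.log (1 - r)
        - ∑ n ∈ Finset.range M, (2 - 1 / ((n + 1 : ℕ) : ℝ)) * r ^ (n + 1))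
      - (1 - Real.log 2)) (Ico 0 1) := by
    have h1 : ∀ r ∈ Ico (0 : ℝ) 1, 1 - r ≠ 0 := fun r hr => by linarith [hr.2]
    have h2 : ContinuousOn (fun r : ℝ => 2 * r / (1 - r)) (Ico 0 1) :=
      ContinuousOn.div₀ (by fun_prop) (by fun_prop) h1
    have h3 : ContinuousOn (fun r : ℝ => Real.log (1 - r)) (Ico 0 1) :=
      ContinuousOn.log (by fun_prop) h1
    fun_prop
  refine h.congr fun r hr => ?_
  rw [radiusFun, radiusFun_tail_eq M hr.1 hr.2]

theorem existsUnique_radiusFun_eq_zero (M : ℕ) :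
    ∃! r : ℝ, r ∈ Ioo (0 : ℝ) 1 ∧ radiusFun (M + 1) r = 0 := by
  have hlog : Real.log 2 < 1 := Real.log_two_lt_d9.trans (by norm_num)
  have hlog' : (1 / 2 : ℝ) < Real.log 2 := lt_trans (by norm_num) Real.log_two_gt_d9
  have h0 : radiusFun (M + 1) 0 < 0 := by
    have : ∀ k : ℕ, (2 - 1 / ((M + 1 + k : ℕ) : ℝ)) * (0 : ℝ) ^ (M + 1 + k) = 0 := fun k => by
      rw [zero_pow (by omega), mul_zero]
    rw [radiusFun, tsum_congr this]
    simp
    linarith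
  -- The first term of the majorant at `1/2` is already `1/2`, which exceeds `1 - log 2`.
  have h1 : 0 < radiusFun (M + 1) (1 / 2) := by
    have h2 := hasSum_two_sub_inv_mul_pow (r := 1 / 2) (by norm_num) (by norm_num)
    have h3 := le_hasSum h2 0 fun n _ => by
      have := one_le_two_sub_inv n
      exact mul_nonneg (by linarith) (by positivity)
    have h4 : 0 ≤ ∑' k : ℕ, (2 - 1 / ((M + 1 + k : ℕ) : ℝ)) * (1 / 2 : ℝ) ^ (M + 1 + k) := by
      refine tsum_nonneg fun k => ?_
      have := one_le_two_sub_inv (M + k)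
      rw [show M + k + 1 = M + 1 + k by omega] at this
      exact mul_nonneg (by linarith) (by positivity)
    rw [radiusFun]
    norm_num at h3 h4 ⊢
    linarith
  obtain ⟨r, hr, hr0⟩ := intermediate_value_Ioo (by norm_num : (0 : ℝ) ≤ 1 / 2)
    ((continuousOn_radiusFun M).mono fun x hx => ⟨hx.1, hx.2.trans_lt (by norm_num)⟩) ⟨h0, h1⟩
  have hr1 : r ∈ Ioo (0 : ℝ) 1 := ⟨hr.1, hr.2.trans (by norm_num)⟩
  refine ⟨r, ⟨hr1, hr0⟩, ?_⟩
  rintro s ⟨hs, hs0⟩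
  exact (strictMonoOn_radiusFun M).injOn ⟨hs.1.le, hs.2⟩ ⟨hr1.1.le, hr1.2⟩ (hs0.trans hr0.symm)

/-! ### The Bohr–Rogosinski inequality -/

theorem NormalizedC1.norm_taylorCoeff_mul_pow_le {f : ℂ → ℂ} (hf : f ∈ NormalizedC1) (z : ℂ)
    (n : ℕ) : ‖taylorCoeff f (n + 1) * z ^ (n + 1)‖
      ≤ (2 - 1 / ((n + 1 : ℕ) : ℝ)) * ‖z‖ ^ (n + 1) := by
  rw [norm_mul, norm_pow]
  exact mul_le_mul_of_nonneg_right (NormalizedC1.norm_taylorCoeff_le hf n) (by positivity)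

theorem NormalizedC1.summable_norm_taylorCoeff {f : ℂ → ℂ} (hf : f ∈ NormalizedC1) (M : ℕ)
    {z : ℂ} (hz : ‖z‖ < 1) :
    Summable fun k : ℕ => ‖taylorCoeff f (M + 1 + k) * z ^ (M + 1 + k)‖ := by
  refine Summable.of_nonneg_of_le (fun _ => norm_nonneg _) (fun k => ?_)
    (summable_radiusFun_tail M (norm_nonneg z) hz)
  have := NormalizedC1.norm_taylorCoeff_mul_pow_le hf z (M + k)
  rwa [show M + k + 1 = M + 1 + k by omega] at this

theorem NormalizedC1.bohrRogosinskiSum_le {f : ℂ → ℂ} (hf : f ∈ NormalizedC1) (M : ℕ)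
    {z : ℂ} (hz : ‖z‖ < 1) :
    bohrRogosinskiSum (M + 1) f z ≤ radiusFun (M + 1) ‖z‖ + (1 - Real.log 2) := by
  have h1 : ‖f z‖ ≤ 2 * ‖z‖ / (1 - ‖z‖) + Real.log (1 - ‖z‖) :=
    (hasSum_taylorCoeff hf.1.1 hf.2.1 (by simpa using hz)).norm_le_of_bounded
      (hasSum_two_sub_inv_mul_pow (norm_nonneg z) hz)
      (NormalizedC1.norm_taylorCoeff_mul_pow_le hf z)
  have h2 := (NormalizedC1.summable_norm_taylorCoeff hf M hz).tsum_le_tsum (fun k => ?_)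
    (summable_radiusFun_tail M (norm_nonneg z) hz)
  · rw [bohrRogosinskiSum, radiusFun]
    linarith
  · have := NormalizedC1.norm_taylorCoeff_mul_pow_le hf z (M + k)
    rwa [show M + k + 1 = M + 1 + k by omega] at this

/-! ### Sharpness -/

/-- The extremal function `z + ∑ (2 - 1/n) z^n`. -/
noncomputable def extremalC1 (z : ℂ) : ℂ := 2 * z / (1 - z) + Complex.log (1 - z)

theorem hasDerivAt_extremalC1 {z : ℂ} (hz : 0 < (1 - z).re) :
    HasDerivAt extremalC1 ((1 + z) / (1 - z) ^ 2) z := by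
  have h0 : 1 - z ≠ 0 := by rintro h; simp [h] at hz
  have h1 : HasDerivAt (fun x : ℂ => 1 - x) (-1) z := (hasDerivAt_id z).const_sub 1
  have h2 : HasDerivAt (fun x : ℂ => 2 * x) 2 z := by simpa using (hasDerivAt_id z).const_mul 2
  refine ((h2.fun_div h1 h0).fun_add (h1.clog (Or.inl hz))).congr_deriv ?_
  field_simp
  ring

theorem one_sub_re_pos {z : ℂ} (hz : z ∈ ball (0 : ℂ) 1) : 0 < (1 - z).re := by
  have h1 : ‖z‖ < 1 := by simpa using hz
  have := Complex.re_le_norm z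
  simp only [Complex.sub_re, Complex.one_re]
  linarith

theorem extremalC1_zero : extremalC1 0 = 0 := by simp [extremalC1]

/-- With `g = z/(1-z)` the quotient `z f'/g` is `(1+z)/(1-z)`, which maps the disc into the right
half-plane. -/
theorem extremalC1_mem : extremalC1 ∈ NormalizedC1 := by
  have h01 : (0 : ℂ) ∈ ball (0 : ℂ) 1 := mem_ball_self one_pos
  refine ⟨⟨fun z hz => (hasDerivAt_extremalC1
    (one_sub_re_pos hz)).differentiableAt.differentiableWithinAt, fun z => z / (1 - z),
    isConvexFunction_div_one_sub, by simp, ?_, ?_⟩, extremalC1_zero, ?_⟩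
  · rw [(hasDerivAt_div_one_sub (by simp)).deriv]
    simp
  · intro z hz hz0
    have h1 := one_sub_ne_zero_of_mem_ball hz
    have h2 : ‖z‖ < 1 := by simpa using hz
    rw [(hasDerivAt_extremalC1 (one_sub_re_pos hz)).deriv,
      show z * ((1 + z) / (1 - z) ^ 2) / (z / (1 - z)) = (1 + z) / (1 - z) by field_simp]
    rw [Complex.div_re, ← add_div]
    refine div_pos ?_ (Complex.normSq_pos.2 h1)
    have h3 : Complex.normSq z < 1 := by
      rw [Complex.normSq_eq_norm_sq]
      nlinarith [norm_nonneg z]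
    rw [Complex.normSq_apply] at h3
    simp only [Complex.add_re, Complex.sub_re, Complex.one_re, Complex.add_im, Complex.sub_im,
      Complex.one_im]
    nlinarith
  · rw [(hasDerivAt_extremalC1 (one_sub_re_pos h01)).deriv]
    simp

theorem extremalC1_ofReal {r : ℝ} (hr : r < 1) :
    extremalC1 r = ((2 * r / (1 - r) + Real.log (1 - r) : ℝ) : ℂ) := by
  rw [extremalC1, Complex.ofReal_add, Complex.ofReal_log (by linarith)]
  push_cast
  rfl

/-- No differentiation is needed: at `z = 1/2` the Taylor series and the majorant have the same sum,
so no coefficient can fall strictly below its bound. -/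
theorem norm_taylorCoeff_extremalC1 (n : ℕ) :
    ‖taylorCoeff extremalC1 (n + 1)‖ = 2 - 1 / ((n + 1 : ℕ) : ℝ) := by
  refine le_antisymm (NormalizedC1.norm_taylorCoeff_le extremalC1_mem n) ?_
  by_contra! hlt
  have hz : ((1 / 2 : ℝ) : ℂ) ∈ ball (0 : ℂ) 1 := by
    rw [mem_ball_zero_iff, Complex.norm_real]; norm_num
  have h1 := Complex.hasSum_re (hasSum_taylorCoeff extremalC1_mem.1.1 extremalC1_zero hz)
  have h2 := hasSum_two_sub_inv_mul_pow (r := 1 / 2) (by norm_num) (by norm_num)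
  rw [extremalC1_ofReal (by norm_num), Complex.ofReal_re] at h1
  have e : ∀ m : ℕ, (taylorCoeff extremalC1 (m + 1) * ((1 / 2 : ℝ) : ℂ) ^ (m + 1)).re
      = (taylorCoeff extremalC1 (m + 1)).re * (1 / 2) ^ (m + 1) := fun m => by
    rw [← Complex.ofReal_pow, Complex.re_mul_ofReal]
  simp only [e] at h1
  refine (hasSum_lt (i := n) (fun m => ?_) ?_ h1 h2).ne rfl
  · exact mul_le_mul_of_nonneg_right ((Complex.re_le_norm _).trans
      (NormalizedC1.norm_taylorCoeff_le extremalC1_mem m)) (by positivity)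
  · exact mul_lt_mul_of_pos_right ((Complex.re_le_norm _).trans_lt hlt) (by positivity)

theorem bohrRogosinskiSum_extremalC1 (M : ℕ) {r : ℝ} (h0 : 0 ≤ r) (h1 : r < 1) :
    bohrRogosinskiSum (M + 1) extremalC1 r = radiusFun (M + 1) r + (1 - Real.log 2) := by
  have h2 : ∀ k : ℕ, ‖taylorCoeff extremalC1 (M + 1 + k) * (r : ℂ) ^ (M + 1 + k)‖
      = (2 - 1 / ((M + 1 + k : ℕ) : ℝ)) * r ^ (M + 1 + k) := by
    intro k
    rw [norm_mul, norm_pow, Complex.norm_real, Real.norm_of_nonneg h0,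
      show M + 1 + k = M + k + 1 by omega, norm_taylorCoeff_extremalC1]
  have h3 : 0 ≤ 2 * r / (1 - r) + Real.log (1 - r) :=
    (hasSum_two_sub_inv_mul_pow h0 h1).nonneg fun n => by
      have := one_le_two_sub_inv n
      exact mul_nonneg (by linarith) (by positivity)
  rw [bohrRogosinskiSum, radiusFun, tsum_congr h2, extremalC1_ofReal h1, Complex.norm_real,
    Real.norm_of_nonneg h3]
  ring

/-- The function is analytic at `-1` with value `-(1 - log 2)`, and this value is a frontier point
at exactly the distance that the covering theorem guarantees. -/
theorem boundaryDist_extremalC1 : boundaryDist extremalC1 = 1 - Real.log 2 := by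
  refine le_antisymm ?_ (NormalizedC1.one_sub_log_two_le_boundaryDist extremalC1_mem)
  have hf : DifferentiableOn ℂ extremalC1 (ball 0 1) := extremalC1_mem.1.1
  obtain ⟨hop, -, h, hh, hleft⟩ := (NormalizedC1.injOn extremalC1_mem).exists_holomorphic_inverse
    isOpen_ball (convex_ball 0 1).isPreconnected hf
  have hball : ∀ t ∈ Ioo (0 : ℝ) 1, (-t : ℂ) ∈ ball (0 : ℂ) 1 := fun t ht => by
    rw [mem_ball_zero_iff, norm_neg, Complex.norm_real, Real.norm_of_nonneg ht.1.le]
    exact ht.2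
  have hneg : Tendsto (fun t : ℝ => (-t : ℂ)) (𝓝[<] 1) (𝓝 (-1)) := by
    have : Continuous fun t : ℝ => (-t : ℂ) := by fun_prop
    simpa using tendsto_nhdsWithin_of_tendsto_nhds (s := Iio 1) (this.tendsto 1)
  have hlim : Tendsto (fun t : ℝ => extremalC1 (-t)) (𝓝[<] 1) (𝓝 (extremalC1 (-1))) :=
    (hasDerivAt_extremalC1 (by norm_num)).continuousAt.tendsto.comp hneg
  have hval : extremalC1 (-1) = ((-(1 - Real.log 2) : ℝ) : ℂ) := by
    have := extremalC1_ofReal (r := -1) (by norm_num)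
    rw [Complex.ofReal_neg, Complex.ofReal_one] at this
    rw [this]
    norm_num
    ring
  have hfr : extremalC1 (-1) ∈ frontier (extremalC1 '' ball 0 1) := by
    rw [hop.frontier_eq]
    constructor
    · refine mem_closure_of_tendsto hlim ?_
      filter_upwards [Ioo_mem_nhdsLT (zero_lt_one' ℝ)] with t ht
      exact mem_image_of_mem _ (hball t ht)
    -- If the value were taken at `y` in the disc, continuity of the inverse along `-t → -1` would
    -- force `y = -1`.
    · rintro ⟨y, hy, hy1⟩
      have h1 : ContinuousAt h (extremalC1 (-1)) :=
        (hh.differentiableAt (hop.mem_nhds ⟨y, hy, hy1⟩)).continuousAt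
      have h2 : Tendsto (fun t : ℝ => (-t : ℂ)) (𝓝[<] 1) (𝓝 (h (extremalC1 (-1)))) := by
        refine (h1.tendsto.comp hlim).congr' ?_
        filter_upwards [Ioo_mem_nhdsLT (zero_lt_one' ℝ)] with t ht
        exact hleft _ (hball t ht)
      have h3 := tendsto_nhds_unique h2 hneg
      rw [← hy1, hleft y hy] at h3
      rw [h3] at hy
      simp at hy
  have h4 := infDist_le_dist_of_mem (x := extremalC1 0) hfr
  have hlog : Real.log 2 < 1 := Real.log_two_lt_d9.trans (by norm_num)
  rw [hval, extremalC1_zero, dist_zero_left, Complex.norm_real, norm_neg,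
    Real.norm_of_nonneg (by linarith)] at h4
  rwa [boundaryDist, extremalC1_zero]

theorem mainTheorem3 (N : ℕ) (hN : 2 ≤ N) :
    (∃! r : ℝ, r ∈ Set.Ioo (0 : ℝ) 1 ∧ radiusFun N r = 0) ∧
    ∀ r ∈ Set.Ioo (0 : ℝ) 1, radiusFun N r = 0 →
      -- the inequality holds for `|z| ≤ r`
      (∀ f ∈ NormalizedC1, ∀ z : ℂ, ‖z‖ ≤ r →
        Summable (fun k : ℕ => ‖taylorCoeff f (N + k) * z ^ (N + k)‖) ∧
        bohrRogosinskiSum N f z ≤ boundaryDist f) ∧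
      -- sharpness: one function gives equality at radius `r` and failure at every larger radius
      (∃ f ∈ NormalizedC1,
        (∃ z : ℂ, ‖z‖ = r ∧ bohrRogosinskiSum N f z = boundaryDist f) ∧
        ∀ ρ ∈ Set.Ioo r 1, ∃ z : ℂ, ‖z‖ = ρ ∧
          boundaryDist f < bohrRogosinskiSum N f z) := by
  obtain ⟨M, rfl⟩ : ∃ M, N = M + 1 := ⟨N - 1, by omega⟩
  refine ⟨existsUnique_radiusFun_eq_zero M, fun r hr hr0 => ⟨fun f hf z hz => ?_, ?_⟩⟩
  · have hz1 : ‖z‖ < 1 := hz.trans_lt hr.2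
    refine ⟨NormalizedC1.summable_norm_taylorCoeff hf M hz1, ?_⟩
    have h1 := NormalizedC1.bohrRogosinskiSum_le hf M hz1
    have h2 := (strictMonoOn_radiusFun M).monotoneOn ⟨norm_nonneg z, hz1⟩ ⟨hr.1.le, hr.2⟩ hz
    have h3 := NormalizedC1.one_sub_log_two_le_boundaryDist hf
    linarith
  · have hnorm : ∀ x : ℝ, 0 ≤ x → ‖(x : ℂ)‖ = x := fun x hx => by
      rw [Complex.norm_real, Real.norm_of_nonneg hx]
    refine ⟨extremalC1, extremalC1_mem, ⟨r, hnorm r hr.1.le, ?_⟩, fun ρ hρ => ?_⟩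
    · rw [bohrRogosinskiSum_extremalC1 M hr.1.le hr.2, hr0, zero_add, boundaryDist_extremalC1]
    · have hρ0 : 0 ≤ ρ := hr.1.le.trans hρ.1.le
      refine ⟨ρ, hnorm ρ hρ0, ?_⟩
      rw [bohrRogosinskiSum_extremalC1 M hρ0 hρ.2, boundaryDist_extremalC1]
      have := strictMonoOn_radiusFun M ⟨hr.1.le, hr.2⟩ ⟨hρ0, hρ.2⟩ hρ.1
      linarith
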